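/- Let $\mathbb N=\{1,2,\dots\}$. For sets $A,B\subset\mathbb N$ write $A<B$ if $a<b$ for all $a\in A$, $b\in B$, and for $n\in\mathbb N$ write $n\le A$ if $n\le a$ for all $a\in A$, and $n<A$ if $n<a$ for all $a\in A$. The Schreier families $\mathcal S_\xi$, $\xi<\omega_1$, of finite subsets of $\mathbb N$ are defined by transfinite induction: $\mathcal S_0=\{\emptyset\}\cup\{\{n\}:n\in\mathbb N\}$, $$\mathcal S_{\gamma+1}=\Big\{\bigcup_{i=1}^nE_i:\ n\in\mathbb N,\ n\le E_1<\dots<E_n,\ E_i\in\mathcal S_\gamma\Big\},$$ and for a limit ordinal $\xi$, $\mathcal S_\xi=\{E:\exists n\le E \text{ with } E\in\mathcal S_{\alpha(\xi,n)}\}$, where $(\alpha(\xi,n))_{n\ge1}$ is a fixed sequence of successor ordinals below $\xi$ increasing to $\xi$ with $\alpha(\xi,1)=1$ and such that $A\cup B\in\mathcal S_{\alpha(\xi,n+1)}$ whenever $n\in\mathbb N$, $A,B\in\mathcal S_{\alpha(\xi,n)}$ and $1<A<B$. For $\xi<\omega_1$ and $0<\theta<1$, a sequence $(E_i)_{i=1}^k$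 of nonempty subsets of $\mathbb N$ is called $\mathcal S_\xi$-admissible if $E_1<\dots<E_k$ and $\{\min E_i:1\le i\le k\}\in\mathcal S_\xi$, and $\mathcal S_\xi$-allowable if the $E_i$ are pairwise disjoint and $\{\min E_i:1\le i\le k\}\in\mathcal S_\xi$. The Tsirelson space $T[\mathcal S_\xi,\theta]$ is the completion of the space $c_{00}$ of finitely supported real sequences under the norm given by the implicit equation $$\|x\|=\max\Big\{\|x\|_\infty,\ \theta\sup\Big\{\sum_{i=1}^k\|E_ix\|:\ k\in\mathbb N,\ (E_i)_{i=1}^k \text{ finite sets forming an } \mathcal S_\xi\text{-admissible sequence}\Big\}\Big\},$$ where $E x$ is the restriction of $x$ to $E$. The support of $y\in T[\mathcal S_\xi,\theta]$ is the set of its nonzero coordinates (with respect to the unit vector basis). Then for every such choice of the sequences $(\alpha(\xi,n))_n$, every $\xi<\omega_1$, every $0<\theta<1$, every $k$, and all vectors $y_1,\dots,y_k\in T[\mathcal S_\xi,\theta]$ of norm one whose supports form an $\mathcal S_\xi$-allowable sequence, $(y_j)_{j=1}^k$ is $\frac\theta3$-equivalent to the unit vector basis of $\ell_1^k$, that is,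 for all real $a_1,\dots,a_k$, $$\frac\theta3\sum_{j=1}^k|a_j|\ \le\ \Big\|\sum_{j=1}^ka_jy_j\Big\|\ \le\ \sum_{j=1}^k|a_j|.$$ -/

import Mathlib

open scoped ENNReal Ordinal

/-- `A < B` for finite sets of positive integers: every element of `A` is smaller than every
element of `B` (in particular `A < ∅` and `∅ < A`). -/
def SetLT (A B : Set ℕ+) : Prop := ∀ a ∈ A, ∀ b ∈ B, a < b

/-- The Schreier family of order `ξ`, with respect to a choice `α` of approximating sequences,
as the predicate `SchreierMem α ξ E` on finite sets `E` of positive integers.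
Order `0`: the empty set and the singletons. Order `γ + 1`: the unions `E₁ ∪ ⋯ ∪ Eₙ` with
`n ≤ E₁ < ⋯ < Eₙ` of order `γ`. Limit order `ξ`: the sets `E` of order `α ξ n` with `n ≤ E`. -/
inductive SchreierMem (α : Ordinal.{0} → ℕ+ → Ordinal.{0}) : Ordinal.{0} → Finset ℕ+ → Prop
  | empty : SchreierMem α 0 ∅
  | singleton (n : ℕ+) : SchreierMem α 0 {n}
  | succ (γ : Ordinal.{0}) (n : ℕ+) (E : Fin n → Finset ℕ+)
      (mem : ∀ i, SchreierMem α γ (E i))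
      (le : ∀ i, ∀ m ∈ E i, n ≤ m)
      (lt : ∀ i j, i < j → SetLT (E i) (E j)) :
      SchreierMem α (Order.succ γ) (Finset.univ.biUnion E)
  | limit (ξ : Ordinal.{0}) (hξ : Order.IsSuccLimit ξ) (n : ℕ+) (E : Finset ℕ+)
      (mem : SchreierMem α (α ξ n) E)
      (le : ∀ m ∈ E, n ≤ m) :
      SchreierMem α ξ E

/-- The Schreier family `𝓢_ξ` of order `ξ`. -/
def schreier (α : Ordinal.{0} → ℕ+ → Ordinal.{0}) (ξ : Ordinal.{0}) : Set (Finset ℕ+) :=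
  {E | SchreierMem α ξ E}

/-- `α` is an admissible choice of approximating sequences: for every countable limit ordinal `ξ`,
`(α ξ n)ₙ` is a sequence of successor ordinals below `ξ` that increases to `ξ` and starts with `1`,
and `A ∪ B ∈ 𝓢_{α ξ (n + 1)}` whenever `A, B ∈ 𝓢_{α ξ n}` and `1 < A < B`. -/
structure IsApproximatingSystem (α : Ordinal.{0} → ℕ+ → Ordinal.{0}) : Prop where
  exists_succ : ∀ ξ < ω₁, Order.IsSuccLimit ξ → ∀ n, ∃ β, α ξ n = Order.succ β
  lt : ∀ ξ < ω₁, Order.IsSuccLimit ξ → ∀ n, α ξ n < ξ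
  mono : ∀ ξ < ω₁, Order.IsSuccLimit ξ → Monotone (α ξ)
  cofinal : ∀ ξ < ω₁, Order.IsSuccLimit ξ → ∀ β < ξ, ∃ n, β < α ξ n
  one : ∀ ξ < ω₁, Order.IsSuccLimit ξ → α ξ 1 = 1
  union_mem : ∀ ξ < ω₁, Order.IsSuccLimit ξ → ∀ (n : ℕ+) (A B : Finset ℕ+),
    A ∈ schreier α (α ξ n) → B ∈ schreier α (α ξ n) → SetLT {1} A → SetLT A B →
    A ∪ B ∈ schreier α (α ξ (n + 1))

/-- The sequence of (nonempty) sets `E₁, …, E_k` is `𝓕`-admissible: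
`E₁ < ⋯ < E_k` and `{min E₁, …, min E_k} ∈ 𝓕`. -/
def IsAdmissible (𝓕 : Set (Finset ℕ+)) {k : ℕ} (E : Fin k → Set ℕ+) : Prop :=
  (∀ i j, i < j → SetLT (E i) (E j)) ∧
    ∃ m : Fin k → ℕ+, (∀ i, IsLeast (E i) (m i)) ∧ Finset.univ.image m ∈ 𝓕

/-- The sequence of (nonempty) sets `E₁, …, E_k` is `𝓕`-allowable:
the sets are pairwise disjoint and `{min E₁, …, min E_k} ∈ 𝓕`. -/
def IsAllowable (𝓕 : Set (Finset ℕ+)) {k : ℕ} (E : Fin k → Set ℕ+) : Prop :=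
  (∀ i j, i ≠ j → Disjoint (E i) (E j)) ∧
    ∃ m : Fin k → ℕ+, (∀ i, IsLeast (E i) (m i)) ∧ Finset.univ.image m ∈ 𝓕

/-- The projection `E x` of a finitely supported sequence `x` onto a finite set `E`. -/
noncomputable def proj (E : Finset ℕ+) (x : ℕ+ →₀ ℝ) : ℕ+ →₀ ℝ := x.filter (· ∈ E)

/-- The iterates, starting at `‖·‖_∞`, of the map
`N ↦ max (‖x‖_∞, θ sup {∑ N (Eᵢ x) : (Eᵢ) is 𝓕-admissible})`. -/
noncomputable def tsirelsonIter (𝓕 : Set (Finset ℕ+)) (θ : ℝ) : ℕ → (ℕ+ →₀ ℝ) → ℝ≥0∞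
  | 0, x => ⨆ n, ‖x n‖ₑ
  | s + 1, x => max (⨆ n, ‖x n‖ₑ) (ENNReal.ofReal θ *
      ⨆ (k : ℕ) (E : Fin k → Finset ℕ+) (_ : IsAdmissible 𝓕 fun i => (E i : Set ℕ+)),
        ∑ i, tsirelsonIter 𝓕 θ s (proj (E i) x))

/-- The Tsirelson norm of a finitely supported sequence: the supremum of the iterates. It is the
unique solution of the implicit equation, see `tsirelsonNorm_eq` and `tsirelsonNorm_unique`. -/
noncomputable def tsirelsonNorm (𝓕 : Set (Finset ℕ+)) (θ : ℝ) (x : ℕ+ →₀ ℝ) : ℝ :=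
  (⨆ s, tsirelsonIter 𝓕 θ s x).toReal

/-- The set of all sums `∑ N (Eᵢ x)` over the `𝓕`-admissible sequences `(Eᵢ)`. -/
def admissibleSums (𝓕 : Set (Finset ℕ+)) (N : (ℕ+ →₀ ℝ) → ℝ) (x : ℕ+ →₀ ℝ) : Set ℝ :=
  {r | ∃ (k : ℕ) (E : Fin k → Finset ℕ+), IsAdmissible 𝓕 (fun i => (E i : Set ℕ+)) ∧
    r = ∑ i, N (proj (E i) x)}

section TsirelsonNorm

variable {𝓕 : Set (Finset ℕ+)} {θ : ℝ}

theorem le_iSup_isAdmissible (g : (k : ℕ) → (Fin k → Finset ℕ+) → ℝ≥0∞) {k : ℕ}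
    {E : Fin k → Finset ℕ+} (hE : IsAdmissible 𝓕 fun i => (E i : Set ℕ+)) :
    g k E ≤ ⨆ (k : ℕ) (E : Fin k → Finset ℕ+) (_ : IsAdmissible 𝓕 fun i => (E i : Set ℕ+)),
      g k E :=
  (le_iSup (fun _ : IsAdmissible 𝓕 fun i => (E i : Set ℕ+) => g k E) hE).trans
    ((le_iSup (fun E : Fin k → Finset ℕ+ =>
      ⨆ _ : IsAdmissible 𝓕 fun i => (E i : Set ℕ+), g k E) E).trans
    (le_iSup (fun k : ℕ => ⨆ (E : Fin k → Finset ℕ+)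
      (_ : IsAdmissible 𝓕 fun i => (E i : Set ℕ+)), g k E) k))

theorem enorm_apply_le_tsirelsonIter (s : ℕ) (x : ℕ+ →₀ ℝ) (n : ℕ+) :
    ‖x n‖ₑ ≤ tsirelsonIter 𝓕 θ s x := by
  cases s with
  | zero => exact le_iSup (fun n => ‖x n‖ₑ) n
  | succ s => exact (le_iSup (fun n => ‖x n‖ₑ) n).trans (le_max_left _ _)

theorem tsirelsonIter_mono (x : ℕ+ →₀ ℝ) : Monotone fun s => tsirelsonIter 𝓕 θ s x := by
  refine monotone_nat_of_le_succ fun s => ?_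
  induction s generalizing x with
  | zero => exact le_max_left _ _
  | succ s ih =>
    refine max_le_max le_rfl (mul_le_mul_right ?_ _)
    exact iSup_mono fun k => iSup_mono fun E => iSup_mono fun _ => Finset.sum_le_sum fun i _ => ih _

theorem tsirelsonIter_add_le (s : ℕ) (x y : ℕ+ →₀ ℝ) :
    tsirelsonIter 𝓕 θ s (x + y) ≤ tsirelsonIter 𝓕 θ s x + tsirelsonIter 𝓕 θ s y := by
  have key : ∀ (t : ℕ) (n : ℕ+), ‖(x + y) n‖ₑ ≤ tsirelsonIter 𝓕 θ t x + tsirelsonIter 𝓕 θ t y :=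
    fun t n => (enorm_add_le _ _).trans
      (add_le_add (enorm_apply_le_tsirelsonIter _ _ _) (enorm_apply_le_tsirelsonIter _ _ _))
  induction s generalizing x y with
  | zero => exact iSup_le (key 0)
  | succ s ih =>
    refine max_le (iSup_le (key _)) ?_
    have : tsirelsonIter 𝓕 θ (s + 1) x + tsirelsonIter 𝓕 θ (s + 1) y ≥ _ :=
      add_le_add (le_max_right _ _) (le_max_right _ _)
    refine le_trans ?_ this
    rw [← mul_add]
    refine mul_le_mul_right (iSup_le fun k => iSup_le fun E => iSup_le fun hE => ?_) _
    calc ∑ i, tsirelsonIter 𝓕 θ s (proj (E i) (x + y))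
        ≤ ∑ i, (tsirelsonIter 𝓕 θ s (proj (E i) x) + tsirelsonIter 𝓕 θ s (proj (E i) y)) := by
          refine Finset.sum_le_sum fun i _ => ?_
          have : proj (E i) (x + y) = proj (E i) x + proj (E i) y := Finsupp.filter_add
          rw [this]
          exact ih _ _ fun t n => (enorm_add_le _ _).trans
            (add_le_add (enorm_apply_le_tsirelsonIter _ _ _) (enorm_apply_le_tsirelsonIter _ _ _))
      _ = ∑ i, tsirelsonIter 𝓕 θ s (proj (E i) x) + ∑ i, tsirelsonIter 𝓕 θ s (proj (E i) y) :=
          Finset.sum_add_distrib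
      _ ≤ _ := add_le_add
          (le_iSup_isAdmissible (fun k E => ∑ i : Fin k, tsirelsonIter 𝓕 θ s (proj (E i) x)) hE)
          (le_iSup_isAdmissible (fun k E => ∑ i : Fin k, tsirelsonIter 𝓕 θ s (proj (E i) y)) hE)

theorem tsirelsonIter_smul (s : ℕ) (c : ℝ) (x : ℕ+ →₀ ℝ) :
    tsirelsonIter 𝓕 θ s (c • x) = ‖c‖ₑ * tsirelsonIter 𝓕 θ s x := by
  have h0 : (⨆ n, ‖(c • x) n‖ₑ) = ‖c‖ₑ * ⨆ n, ‖x n‖ₑ := by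
    simp [ENNReal.mul_iSup, enorm_mul]
  induction s generalizing x with
  | zero => exact h0
  | succ s ih =>
    simp only [tsirelsonIter]
    rw [h0, mul_max, mul_left_comm ‖c‖ₑ]
    congr 2
    simp only [ENNReal.mul_iSup, Finset.mul_sum]
    refine iSup_congr fun k => iSup_congr fun E => iSup_congr fun hE =>
      Finset.sum_congr rfl fun i _ => ?_
    have : proj (E i) (c • x) = c • proj (E i) x := Finsupp.filter_smul
    rw [this]
    exact ih _ (by simp [ENNReal.mul_iSup, enorm_mul])

theorem IsAdmissible.disjoint {k : ℕ} {E : Fin k → Finset ℕ+}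
    (hE : IsAdmissible 𝓕 fun i => (E i : Set ℕ+)) {i j : Fin k} (hij : i ≠ j) {n : ℕ+}
    (hi : n ∈ E i) (hj : n ∈ E j) : False := by
  rcases lt_or_gt_of_ne hij with h | h
  · exact lt_irrefl _ (hE.1 i j h n (by simpa using hi) n (by simpa using hj))
  · exact lt_irrefl _ (hE.1 j i h n (by simpa using hj) n (by simpa using hi))

theorem tsirelsonIter_le_sum (hθ : θ ≤ 1) (s : ℕ) (x : ℕ+ →₀ ℝ) (A : Finset ℕ+)
    (hA : x.support ⊆ A) : tsirelsonIter 𝓕 θ s x ≤ ∑ n ∈ A, ‖x n‖ₑ := by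
  have h0 : (⨆ n, ‖x n‖ₑ) ≤ ∑ n ∈ A, ‖x n‖ₑ := by
    refine iSup_le fun n => ?_
    by_cases hn : x n = 0
    · simp [hn]
    · exact Finset.single_le_sum (f := fun n => ‖x n‖ₑ) (fun _ _ => zero_le)
        (hA (Finsupp.mem_support_iff.2 hn))
  induction s generalizing x with
  | zero => exact h0
  | succ s ih =>
    refine max_le h0 ?_
    refine le_trans (mul_le_of_le_one_left' (ENNReal.ofReal_le_one.2 hθ)) ?_
    refine iSup_le fun k => iSup_le fun E => iSup_le fun hE => ?_
    have hs : ∀ i, (proj (E i) x).support ⊆ A := fun i =>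
      (Finsupp.support_filter (p := (· ∈ E i)) (f := x) ▸ Finset.filter_subset _ _).trans hA
    calc ∑ i, tsirelsonIter 𝓕 θ s (proj (E i) x)
        ≤ ∑ i, ∑ n ∈ A, ‖proj (E i) x n‖ₑ := by
          refine Finset.sum_le_sum fun i _ => ih _ (hs i) (iSup_le fun n => ?_)
          by_cases hn : proj (E i) x n = 0
          · simp [hn]
          · exact Finset.single_le_sum (f := fun n => ‖proj (E i) x n‖ₑ) (fun _ _ => zero_le)
              (hs i (Finsupp.mem_support_iff.2 hn))
      _ = ∑ n ∈ A, ∑ i, ‖proj (E i) x n‖ₑ := Finset.sum_comm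
      _ ≤ ∑ n ∈ A, ‖x n‖ₑ := by
          refine Finset.sum_le_sum fun n _ => ?_
          by_cases h : ∃ i, n ∈ E i
          · obtain ⟨i, hi⟩ := h
            rw [Finset.sum_eq_single i]
            · simp [proj, hi]
            · intro j _ hji
              have : n ∉ E j := fun hj => hE.disjoint hji hj hi
              simp [proj, this]
            · simp
          · push Not at h
            simp [proj, h]

theorem iSup_tsirelsonIter_ne_top (hθ : θ ≤ 1) (x : ℕ+ →₀ ℝ) :
    ⨆ s, tsirelsonIter 𝓕 θ s x ≠ ∞ := by
  refine ne_top_of_le_ne_top ?_ (iSup_le fun s => tsirelsonIter_le_sum hθ s x _ subset_rfl)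
  exact ENNReal.sum_ne_top.2 fun _ _ => enorm_ne_top

theorem tsirelsonNorm_nonneg (x : ℕ+ →₀ ℝ) : 0 ≤ tsirelsonNorm 𝓕 θ x := ENNReal.toReal_nonneg

theorem abs_apply_le_tsirelsonNorm (hθ : θ ≤ 1) (x : ℕ+ →₀ ℝ) (n : ℕ+) :
    |x n| ≤ tsirelsonNorm 𝓕 θ x := by
  have := ENNReal.toReal_mono (iSup_tsirelsonIter_ne_top (𝓕 := 𝓕) hθ x)
    (le_iSup_of_le 0 (enorm_apply_le_tsirelsonIter 0 x n))
  simpa [tsirelsonNorm] using this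

theorem tsirelsonNorm_add_le (hθ : θ ≤ 1) (x y : ℕ+ →₀ ℝ) :
    tsirelsonNorm 𝓕 θ (x + y) ≤ tsirelsonNorm 𝓕 θ x + tsirelsonNorm 𝓕 θ y := by
  have hx := iSup_tsirelsonIter_ne_top (𝓕 := 𝓕) hθ x
  have hy := iSup_tsirelsonIter_ne_top (𝓕 := 𝓕) hθ y
  unfold tsirelsonNorm
  rw [← ENNReal.toReal_add hx hy]
  refine ENNReal.toReal_mono (ENNReal.add_ne_top.2 ⟨hx, hy⟩) (iSup_le fun s => ?_)
  exact (tsirelsonIter_add_le s x y).trans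
    (add_le_add (le_iSup (fun s => tsirelsonIter 𝓕 θ s x) s)
      (le_iSup (fun s => tsirelsonIter 𝓕 θ s y) s))

theorem tsirelsonNorm_smul (c : ℝ) (x : ℕ+ →₀ ℝ) :
    tsirelsonNorm 𝓕 θ (c • x) = |c| * tsirelsonNorm 𝓕 θ x := by
  simp only [tsirelsonNorm, tsirelsonIter_smul, ← ENNReal.mul_iSup, ENNReal.toReal_mul]
  simp

theorem tsirelsonNorm_zero : tsirelsonNorm 𝓕 θ 0 = 0 := by
  simpa using tsirelsonNorm_smul (𝓕 := 𝓕) (θ := θ) 0 0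

theorem iSup_tsirelsonIter_eq (x : ℕ+ →₀ ℝ) :
    ⨆ s, tsirelsonIter 𝓕 θ s x = max (⨆ n, ‖x n‖ₑ) (ENNReal.ofReal θ *
      ⨆ (k : ℕ) (E : Fin k → Finset ℕ+) (_ : IsAdmissible 𝓕 fun i => (E i : Set ℕ+)),
        ∑ i, ⨆ s, tsirelsonIter 𝓕 θ s (proj (E i) x)) := by
  apply le_antisymm
  · refine iSup_le fun s => ?_
    cases s with
    | zero => exact le_max_left _ _
    | succ s =>
      refine max_le_max le_rfl (mul_le_mul_right ?_ _)
      exact iSup_mono fun k => iSup_mono fun E => iSup_mono fun _ => Finset.sum_le_sum fun i _ =>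
        le_iSup (fun s => tsirelsonIter 𝓕 θ s (proj (E i) x)) s
  · refine max_le (le_iSup_of_le 0 le_rfl) ?_
    simp only [ENNReal.mul_iSup]
    refine iSup_le fun k => iSup_le fun E => iSup_le fun hE => ?_
    rw [ENNReal.finsetSum_iSup_of_monotone fun i => tsirelsonIter_mono _, ENNReal.mul_iSup]
    refine iSup_le fun s => le_iSup_of_le (s + 1) (le_trans ?_ (le_max_right _ _))
    exact mul_le_mul_right
      (le_iSup_isAdmissible (fun k E => ∑ i : Fin k, tsirelsonIter 𝓕 θ s (proj (E i) x)) hE) _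

theorem bddAbove_range_abs (x : ℕ+ →₀ ℝ) : BddAbove (Set.range fun n => |x n|) :=
  ⟨tsirelsonNorm ∅ 1 x, by rintro _ ⟨n, rfl⟩; exact abs_apply_le_tsirelsonNorm le_rfl x n⟩

theorem mul_le_tsirelsonNorm (hθ : 0 < θ) (hθ' : θ ≤ 1) (x : ℕ+ →₀ ℝ) :
    ∀ r ∈ admissibleSums 𝓕 (tsirelsonNorm 𝓕 θ) x, θ * r ≤ tsirelsonNorm 𝓕 θ x := by
  rintro r ⟨k, E, hE, rfl⟩
  have htop := iSup_tsirelsonIter_ne_top (𝓕 := 𝓕) hθ'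
  have h : ENNReal.ofReal θ * ∑ i, ⨆ s, tsirelsonIter 𝓕 θ s (proj (E i) x) ≤
      ⨆ s, tsirelsonIter 𝓕 θ s x := by
    rw [iSup_tsirelsonIter_eq x]
    exact (mul_le_mul_right
      (le_iSup_isAdmissible
        (fun k E => ∑ i : Fin k, ⨆ s, tsirelsonIter 𝓕 θ s (proj (E i) x)) hE) _).trans (le_max_right _ _)
  have := ENNReal.toReal_mono (htop x) h
  rwa [ENNReal.toReal_mul, ENNReal.toReal_ofReal hθ.le,
    ENNReal.toReal_sum fun i _ => htop _] at this

/-- The Tsirelson norm solves the implicit equation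
`‖x‖ = max (‖x‖_∞, θ sup {∑ ‖Eᵢ x‖ : (Eᵢ) is 𝓕-admissible})`, with a finite supremum. -/
theorem tsirelsonNorm_eq (hθ : 0 < θ) (hθ' : θ ≤ 1) (x : ℕ+ →₀ ℝ) :
    BddAbove (admissibleSums 𝓕 (tsirelsonNorm 𝓕 θ) x) ∧
      tsirelsonNorm 𝓕 θ x =
        max (⨆ n, |x n|) (θ * sSup (admissibleSums 𝓕 (tsirelsonNorm 𝓕 θ) x)) := by
  have hle := mul_le_tsirelsonNorm (𝓕 := 𝓕) hθ hθ' x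
  have htop := iSup_tsirelsonIter_ne_top (𝓕 := 𝓕) hθ'
  have hnonneg : ∀ r ∈ admissibleSums 𝓕 (tsirelsonNorm 𝓕 θ) x, 0 ≤ r := by
    rintro r ⟨k, E, hE, rfl⟩
    exact Finset.sum_nonneg fun i _ => tsirelsonNorm_nonneg _
  have hbdd : BddAbove (admissibleSums 𝓕 (tsirelsonNorm 𝓕 θ) x) :=
    ⟨tsirelsonNorm 𝓕 θ x / θ, fun r hr => by
      rw [le_div_iff₀ hθ, mul_comm]; exact hle r hr⟩
  have hS : 0 ≤ sSup (admissibleSums 𝓕 (tsirelsonNorm 𝓕 θ) x) := Real.sSup_nonneg hnonneg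
  refine ⟨hbdd, le_antisymm ?_ (max_le (ciSup_le (abs_apply_le_tsirelsonNorm hθ' x)) ?_)⟩
  · refine ENNReal.toReal_le_of_le_ofReal (le_max_of_le_right (by positivity)) ?_
    rw [iSup_tsirelsonIter_eq x]
    refine max_le (iSup_le fun n => ?_) ?_
    · rw [← ofReal_norm]
      exact ENNReal.ofReal_le_ofReal
        ((le_ciSup (bddAbove_range_abs x) n).trans (le_max_left _ _))
    · refine le_trans ?_ (ENNReal.ofReal_le_ofReal (le_max_right _ _))
      rw [ENNReal.ofReal_mul hθ.le]
      refine mul_le_mul_right (iSup_le fun k => iSup_le fun E => iSup_le fun hE => ?_) _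
      refine ENNReal.le_ofReal_iff_toReal_le
        (ENNReal.sum_ne_top.2 fun i _ => htop _) hS |>.2 ?_
      rw [ENNReal.toReal_sum fun i _ => htop _]
      exact le_csSup hbdd ⟨k, E, hE, rfl⟩
  · rw [mul_comm, ← le_div_iff₀ hθ]
    refine Real.sSup_le (fun r hr => ?_) (div_nonneg (tsirelsonNorm_nonneg _) hθ.le)
    rw [le_div_iff₀ hθ, mul_comm]; exact hle r hr

/-- Comparison of two solutions of the implicit equation, one of which vanishes at `0`. -/
theorem implicit_le (hθ : 0 < θ) (hθ' : θ < 1) (N M : (ℕ+ →₀ ℝ) → ℝ) (hN0 : N 0 = 0)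
    (hM0 : ∀ x, 0 ≤ M x)
    (hN : ∀ x, N x = max (⨆ n, |x n|) (θ * sSup (admissibleSums 𝓕 N x)))
    (hM : ∀ x, BddAbove (admissibleSums 𝓕 M x) ∧
      M x = max (⨆ n, |x n|) (θ * sSup (admissibleSums 𝓕 M x))) (x : ℕ+ →₀ ℝ) :
    N x ≤ M x := by
  induction hc : x.support.card using Nat.strong_induction_on generalizing x with
  | _ c ih =>
  by_contra! hlt
  have hNx : 0 < N x := (hM0 x).trans_lt hlt
  have hsup : ⨆ n, |x n| ≤ M x := (hM x).2 ▸ le_max_left _ _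
  have hMS : θ * sSup (admissibleSums 𝓕 M x) ≤ M x := by
    conv_rhs => rw [(hM x).2]
    exact le_max_right _ _
  have hlt' : max (M x / θ) (N x) < N x / θ := by
    refine max_lt (by gcongr) ?_
    rw [lt_div_iff₀ hθ]; nlinarith
  have hS : sSup (admissibleSums 𝓕 N x) ≤ max (M x / θ) (N x) := by
    refine Real.sSup_le ?_ (le_max_of_le_right hNx.le)
    rintro r ⟨k, E, hE, rfl⟩
    by_cases h : ∃ i, x.support ⊆ E i
    · obtain ⟨i, hi⟩ := h
      refine le_max_of_le_right (le_of_eq ?_)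
      rw [Finset.sum_eq_single i]
      · congr 1
        exact (Finsupp.filter_eq_self_iff _ _).2 fun n hn => hi (Finsupp.mem_support_iff.2 hn)
      · intro j _ hji
        have : proj (E j) x = 0 := (Finsupp.filter_eq_zero_iff _ _).2 fun n hn => by
          by_contra hx
          exact hE.disjoint hji hn (hi (Finsupp.mem_support_iff.2 hx))
        rw [this, hN0]
      · simp
    · push Not at h
      refine le_max_of_le_left ?_
      have h1 : ∑ i, N (proj (E i) x) ≤ ∑ i, M (proj (E i) x) := by
        refine Finset.sum_le_sum fun i _ => ih _ ?_ _ rfl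
        rw [← hc]
        refine Finset.card_lt_card ((Finset.ssubset_iff_subset_ne).2 ⟨?_, fun heq => h i ?_⟩)
        · exact Finsupp.support_filter (p := (· ∈ E i)) (f := x) ▸ Finset.filter_subset _ _
        · rw [← heq]
          intro n hn
          have := Finsupp.support_filter (p := (· ∈ E i)) (f := x) ▸ hn
          exact (Finset.mem_filter.1 this).2
      refine h1.trans ?_
      rw [le_div_iff₀ hθ, mul_comm]
      exact (mul_le_mul_of_nonneg_left (le_csSup (hM x).1 ⟨k, E, hE, rfl⟩) hθ.le).trans hMS
  have : N x ≤ max (M x) (θ * max (M x / θ) (N x)) := by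
    conv_lhs => rw [hN x]
    exact max_le_max hsup (mul_le_mul_of_nonneg_left hS hθ.le)
  rcases le_max_iff.1 this with h | h
  · exact absurd h (not_le.2 hlt)
  · rw [lt_div_iff₀ hθ] at hlt'
    linarith

/-- The Tsirelson norm is the only solution of the implicit equation that vanishes at `0`. -/
theorem tsirelsonNorm_unique (hθ : 0 < θ) (hθ' : θ < 1) (N : (ℕ+ →₀ ℝ) → ℝ) (hN0 : N 0 = 0)
    (hN : ∀ x, BddAbove (admissibleSums 𝓕 N x) ∧
      N x = max (⨆ n, |x n|) (θ * sSup (admissibleSums 𝓕 N x))) : N = tsirelsonNorm 𝓕 θ := by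
  have hpos : ∀ x, 0 ≤ N x := fun x => by
    rw [(hN x).2]
    exact le_max_of_le_left (Real.iSup_nonneg fun n => abs_nonneg _)
  funext x
  exact le_antisymm
    (implicit_le hθ hθ' N _ hN0 tsirelsonNorm_nonneg (fun x => (hN x).2)
      (tsirelsonNorm_eq hθ hθ'.le) x)
    (implicit_le hθ hθ' _ N tsirelsonNorm_zero hpos (fun x => (tsirelsonNorm_eq hθ hθ'.le x).2)
      hN x)

end TsirelsonNorm

/-- The space `c₀₀` of finitely supported real sequences, equipped with the Tsirelson norm
for the family `𝓕` and the number `θ ∈ (0, 1)`. -/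
def TsirelsonC00 (_𝓕 : Set (Finset ℕ+)) (_θ : Set.Ioo (0 : ℝ) 1) : Type := ℕ+ →₀ ℝ

noncomputable section

variable (𝓕 : Set (Finset ℕ+)) (θ : Set.Ioo (0 : ℝ) 1)

instance : AddCommGroup (TsirelsonC00 𝓕 θ) := inferInstanceAs (AddCommGroup (ℕ+ →₀ ℝ))

instance : Module ℝ (TsirelsonC00 𝓕 θ) := inferInstanceAs (Module ℝ (ℕ+ →₀ ℝ))

instance : Norm (TsirelsonC00 𝓕 θ) := ⟨fun x => tsirelsonNorm 𝓕 θ x⟩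

theorem TsirelsonC00.core : NormedSpace.Core ℝ (TsirelsonC00 𝓕 θ) where
  norm_nonneg x := tsirelsonNorm_nonneg (𝓕 := 𝓕) (θ := θ) x
  norm_smul c x := tsirelsonNorm_smul (𝓕 := 𝓕) (θ := θ) c x
  norm_triangle x y := tsirelsonNorm_add_le (𝓕 := 𝓕) θ.2.2.le x y
  norm_eq_zero_iff x := by
    refine ⟨fun h => Finsupp.ext fun n => ?_, fun h => h ▸ tsirelsonNorm_zero⟩
    exact abs_nonpos_iff.1
      ((abs_apply_le_tsirelsonNorm (𝓕 := 𝓕) θ.2.2.le (x : ℕ+ →₀ ℝ) n).trans (le_of_eq h))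

instance : NormedAddCommGroup (TsirelsonC00 𝓕 θ) :=
  NormedAddCommGroup.ofCore (TsirelsonC00.core 𝓕 θ)

instance : NormedSpace ℝ (TsirelsonC00 𝓕 θ) :=
  NormedSpace.ofCore (TsirelsonC00.core 𝓕 θ)

/-- The Tsirelson space `T[𝓕, θ]`: the completion of `c₀₀` under the Tsirelson norm. -/
abbrev TsirelsonSpace : Type := UniformSpace.Completion (TsirelsonC00 𝓕 θ)

variable {𝓕 θ}

/-- The `n`-th coordinate functional on `c₀₀`. -/
def TsirelsonC00.coord (n : ℕ+) : TsirelsonC00 𝓕 θ →L[ℝ] ℝ :=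
  LinearMap.mkContinuous (Finsupp.lapply n : (ℕ+ →₀ ℝ) →ₗ[ℝ] ℝ) 1 fun x =>
    (abs_apply_le_tsirelsonNorm (𝓕 := 𝓕) θ.2.2.le (x : ℕ+ →₀ ℝ) n).trans (one_mul _).ge

/-- The `n`-th coordinate functional on `T[𝓕, θ]`: the continuous extension of the one on `c₀₀`. -/
def TsirelsonSpace.coord (n : ℕ+) : TsirelsonSpace 𝓕 θ →L[ℝ] ℝ :=
  (TsirelsonC00.coord n).fromCompletion

/-- The support of a vector of `T[𝓕, θ]`: the set of its nonzero coordinates. -/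
def TsirelsonSpace.supp (y : TsirelsonSpace 𝓕 θ) : Set ℕ+ := {n | TsirelsonSpace.coord n y ≠ 0}

end

/-! Iterating the implicit equation writes the norm of a finitely supported vector, up to `ε`, as a
sum `∑ θ ^ δ n * |x n|` over the leaves of a tree in which the children of every node are
admissible. Hanging such trees for disjointly supported vectors below a new root, whose children are
only allowable, gives a functional that is worth `θ` times the sum of the norms on the sum of the
vectors. It lies in the norming set of the modified space, where disjointness replaces succession.
It remains to bound such functionals by three times the Tsirelson norm.

Only numerical data of the tree are kept (`IsScheme`). The engine is `HasGrouping`: members of the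
Schreier family, however interlaced, can be recut into successive members without starting too
early. It is proved by induction on `ξ`; the limit step rests on the union property of `α`. With it,
the tree is straightened from its deepest level upwards (`exists_blocks`, `dominated_of_split`). The
leaves of depth at least `e` are cut into intervals, and up to any point `n` there are at most as
many intervals as nodes of depth `e` starting by `n`.

A leaf of depth `e` may cut an interval in two, which costs two units of this budget while the leaf
brings only one. Hence every second leaf of each depth can be handled: the leaves of even rank form
one dominated functional, those of odd rank at least three another. The leaves of rank one, at most
one for each depth, need only three successive sets per level, which are admissible when their
minima are at least 3. The coordinate 2 joins the second class, since nothing lies to its left.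
Three functionals give the constant 3 (`IsScheme.sum_le`), and truncation transfers the estimate to
the completion. -/

section Schreier

/-! ### Stability properties of the Schreier families. -/

variable {α : Ordinal.{0} → ℕ+ → Ordinal.{0}} {ξ : Ordinal.{0}}

theorem schreier_zero_iff {E : Finset ℕ+} : E ∈ schreier α 0 ↔ E.card ≤ 1 := by
  constructor
  · intro h
    change SchreierMem α 0 E at h
    generalize h0 : (0 : Ordinal.{0}) = ζ at h
    cases h with
    | empty => simp
    | singleton n => simp
    | succ γ n E mem le lt => exact absurd h0.symm (Order.succ_ne_bot γ)
    | limit ξ hξ n E mem le => exact absurd h0.symm hξ.ne_bot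
  · intro h
    rcases Finset.card_le_one_iff_subset_singleton.1 h with ⟨x, hx⟩
    rcases Finset.subset_singleton_iff.1 hx with rfl | rfl
    exacts [SchreierMem.empty, SchreierMem.singleton x]

theorem schreier_succ_iff {γ : Ordinal.{0}} {F : Finset ℕ+} :
    F ∈ schreier α (Order.succ γ) ↔ ∃ (n : ℕ+) (E : Fin n → Finset ℕ+),
      (∀ i, E i ∈ schreier α γ) ∧ (∀ m ∈ F, n ≤ m) ∧ (∀ i j, i < j → SetLT (E i) (E j)) ∧
        F = Finset.univ.biUnion E := by
  constructor
  · intro h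
    change SchreierMem α _ F at h
    generalize h0 : Order.succ γ = ζ at h
    cases h with
    | empty => exact absurd h0 (Order.succ_ne_bot γ)
    | singleton n => exact absurd h0 (Order.succ_ne_bot γ)
    | succ γ' n E mem le lt =>
      obtain rfl := Order.succ_injective h0
      refine ⟨n, E, mem, fun m hm => ?_, lt, rfl⟩
      obtain ⟨i, -, hi⟩ := Finset.mem_biUnion.1 hm
      exact le i m hi
    | limit ξ hξ n E mem le => exact absurd (h0 ▸ hξ) (Order.not_isSuccLimit_succ γ)
  · rintro ⟨n, E, mem, le, lt, rfl⟩
    exact SchreierMem.succ γ n E mem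
      (fun i m hm => le m (Finset.mem_biUnion.2 ⟨i, Finset.mem_univ _, hm⟩)) lt

theorem schreier_limit_iff (hξ : Order.IsSuccLimit ξ) {F : Finset ℕ+} :
    F ∈ schreier α ξ ↔ ∃ n : ℕ+, F ∈ schreier α (α ξ n) ∧ ∀ m ∈ F, n ≤ m := by
  constructor
  · intro h
    change SchreierMem α ξ F at h
    cases h with
    | empty => exact absurd rfl hξ.ne_bot
    | singleton n => exact absurd rfl hξ.ne_bot
    | succ γ' n E mem le lt => exact absurd hξ (Order.not_isSuccLimit_succ _)
    | limit ξ hξ n E mem le => exact ⟨n, mem, le⟩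
  · rintro ⟨n, mem, le⟩
    exact SchreierMem.limit ξ hξ n F mem le

/-- Schreier families are hereditary and spreading. -/
theorem schreier_spread {E : Finset ℕ+} (hE : E ∈ schreier α ξ) {F : Finset ℕ+} (φ : ℕ+ → ℕ+)
    (hφ : StrictMonoOn φ F) (hmem : ∀ n ∈ F, φ n ∈ E) (hle : ∀ n ∈ F, φ n ≤ n) :
    F ∈ schreier α ξ := by
  change SchreierMem α ξ E at hE
  induction hE generalizing F with
  | empty =>
    have : F = ∅ := Finset.eq_empty_of_forall_notMem fun n hn => by simpa using hmem n hn
    exact this ▸ SchreierMem.empty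
  | singleton n =>
    refine schreier_zero_iff.2 (Finset.card_le_one.2 fun a ha b hb => hφ.injOn ha hb ?_)
    rw [Finset.mem_singleton.1 (hmem a ha), Finset.mem_singleton.1 (hmem b hb)]
  | succ γ n E mem le lt ih =>
    refine schreier_succ_iff.2 ⟨n, fun i => F.filter (φ · ∈ E i), fun i => ?_, fun m hm => ?_,
      fun i j hij a ha b hb => ?_, ?_⟩
    · exact ih i (hφ.mono fun n hn => (Finset.mem_filter.1 hn).1)
        (fun n hn => (Finset.mem_filter.1 hn).2) fun n hn => hle n (Finset.mem_filter.1 hn).1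
    · obtain ⟨i, -, hi⟩ := Finset.mem_biUnion.1 (hmem m hm)
      exact (le i _ hi).trans (hle m hm)
    · simp only [Finset.coe_filter, Set.mem_ofPred_eq] at ha hb
      exact (hφ.lt_iff_lt ha.1 hb.1).1 (lt i j hij _ ha.2 _ hb.2)
    · ext m
      simp only [Finset.mem_biUnion, Finset.mem_univ, true_and, Finset.mem_filter]
      constructor
      · intro hm
        obtain ⟨i, -, hi⟩ := Finset.mem_biUnion.1 (hmem m hm)
        exact ⟨i, hm, hi⟩
      · rintro ⟨i, hm, -⟩; exact hm
  | limit ζ hζ n E mem le ih =>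
    exact (schreier_limit_iff hζ).2 ⟨n, ih hφ hmem hle, fun m hm => (le _ (hmem m hm)).trans (hle m hm)⟩

theorem schreier_subset {E F : Finset ℕ+} (hE : E ∈ schreier α ξ) (h : F ⊆ E) :
    F ∈ schreier α ξ :=
  schreier_spread hE id strictMonoOn_id (fun _ hn => h hn) fun _ _ => le_rfl

theorem singleton_mem_schreier (hα : IsApproximatingSystem α) (hξ : ξ < ω₁) (n : ℕ+) :
    {n} ∈ schreier α ξ := by
  induction ξ using WellFoundedLT.induction with
  | _ ξ ih =>
  rcases Ordinal.zero_or_succ_or_isSuccLimit ξ with rfl | ⟨γ, rfl⟩ | hl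
  · exact SchreierMem.singleton n
  · refine schreier_succ_iff.2 ⟨1, fun _ => {n}, fun _ => ih γ (Order.lt_succ γ)
      ((Order.lt_succ γ).trans hξ), fun _ _ => one_le, fun i j hij => ?_, ?_⟩
    · exact absurd (Subsingleton.elim (α := Fin 1) i j) hij.ne
    · ext m
      simp only [Finset.mem_biUnion, Finset.mem_univ, true_and]
      exact ⟨fun h => ⟨(0 : Fin 1), h⟩, fun ⟨_, h⟩ => h⟩
  · have := hα.lt ξ hξ hl 1
    exact (schreier_limit_iff hl).2 ⟨1, ih _ this (this.trans hξ), fun _ _ => one_le⟩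

theorem empty_mem_schreier (hα : IsApproximatingSystem α) (hξ : ξ < ω₁) :
    ∅ ∈ schreier α ξ :=
  schreier_subset (singleton_mem_schreier hα hξ 1) (Finset.empty_subset _)

/-- The bound `n ≤ 1` at a successor step leaves room for a single piece only. This lets the
coordinate 1 be excluded later, where the union property of `α` needs sets beyond 1. -/
theorem eq_one_of_one_mem_schreier {A : Finset ℕ+} (hA : A ∈ schreier α ξ) (h : 1 ∈ A) :
    ∀ n ∈ A, n = 1 := by
  change SchreierMem α ξ A at hA
  induction hA with
  | empty => simp
  | singleton n => simp_all
  | succ γ n E mem le lt ih =>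
    obtain ⟨i, -, hi⟩ := Finset.mem_biUnion.1 h
    obtain rfl : n = 1 := le_antisymm (le i 1 hi) one_le
    intro m hm
    obtain ⟨j, -, hj⟩ := Finset.mem_biUnion.1 hm
    obtain rfl := Subsingleton.elim (α := Fin 1) i j
    exact ih i hi m hj
  | limit ζ hζ n E mem le ih => exact ih h

/-- Sets of at most `n` elements that start after `n` belong to the families of order `≥ 1`. -/
theorem mem_schreier_of_card_le (hα : IsApproximatingSystem α) (hξ : ξ < ω₁) (h0 : ξ ≠ 0) (n : ℕ+)
    {A : Finset ℕ+} (hA : A.card ≤ n) (hn : ∀ m ∈ A, n ≤ m) : A ∈ schreier α ξ := by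
  -- Successor orders suffice: at a limit the term `α ξ n` is itself a successor. The pieces are the
  -- singletons of `A`, indexed by the number of smaller elements.
  have key : ∀ γ, γ < ω₁ → A ∈ schreier α (Order.succ γ) := by
    intro γ hγ
    have hrange (i : Fin n) (m) (hm : m ∈ A.filter fun m => (A.filter (· < m)).card = (i : ℕ)) :
        m ∈ A ∧ (A.filter (· < m)).card = (i : ℕ) := by simpa using hm
    have hlt {a b : ℕ+} (ha : a ∈ A) (hab : a < b) :
        (A.filter (· < a)).card < (A.filter (· < b)).card := by
      refine Finset.card_lt_card ⟨fun m hm => ?_, fun h => ?_⟩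
      · simp only [Finset.mem_filter] at hm ⊢
        exact ⟨hm.1, hm.2.trans hab⟩
      · simpa using h (Finset.mem_filter.2 ⟨ha, hab⟩)
    refine schreier_succ_iff.2 ⟨n, fun i => A.filter fun m => (A.filter (· < m)).card = (i : ℕ),
      fun i => ?_, hn, fun i j hij a ha b hb => ?_, ?_⟩
    · have hc : (A.filter fun m => (A.filter (· < m)).card = (i : ℕ)).card ≤ 1 := by
        refine Finset.card_le_one.2 fun a ha b hb => ?_
        obtain ⟨ha, ha'⟩ := hrange i a ha
        obtain ⟨hb, hb'⟩ := hrange i b hb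
        rcases lt_trichotomy a b with h | h | h
        · have := hlt ha h; omega
        · exact h
        · have := hlt hb h; omega
      rcases Finset.card_le_one_iff_subset_singleton.1 hc with ⟨x, hx⟩
      exact schreier_subset (singleton_mem_schreier hα hγ x) hx
    · obtain ⟨ha, ha'⟩ := hrange i a (by simpa using ha)
      obtain ⟨hb, hb'⟩ := hrange j b (by simpa using hb)
      by_contra! h
      rcases h.eq_or_lt with rfl | h
      · have : (i : ℕ) < j := hij
        omega
      · have := hlt hb h
        have : (i : ℕ) < j := hij
        omega
    · ext m
      simp only [Finset.mem_biUnion, Finset.mem_univ, true_and, Finset.mem_filter]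
      refine ⟨fun hm => ⟨⟨(A.filter (· < m)).card, ?_⟩, hm, rfl⟩, fun ⟨_, hm, _⟩ => hm⟩
      refine lt_of_lt_of_le (Finset.card_lt_card ⟨Finset.filter_subset _ _, fun h => ?_⟩) hA
      simpa using h hm
  rcases Ordinal.zero_or_succ_or_isSuccLimit ξ with rfl | ⟨γ, rfl⟩ | hl
  · exact absurd rfl h0
  · exact key γ ((Order.lt_succ γ).trans hξ)
  · obtain ⟨γ, hγ⟩ := hα.exists_succ ξ hξ hl n
    have := hα.lt ξ hξ hl n
    rw [hγ] at this
    exact (schreier_limit_iff hl).2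
      ⟨n, hγ ▸ key γ (((Order.lt_succ γ).trans this).trans hξ), hn⟩

/-- The last element of a Schreier set may be moved to the left, up to its predecessor. -/
theorem insert_mem_schreier_of_le (hα : IsApproximatingSystem α) (hξ : ξ < ω₁) {F : Finset ℕ+}
    (hF : F.Nonempty) {y z : ℕ+} (hz : insert z F ∈ schreier α ξ) (hy : ∀ f ∈ F, f < y)
    (hyz : y ≤ z) : insert y F ∈ schreier α ξ := by
  have main : ∀ {ξ : Ordinal.{0}} {E : Finset ℕ+}, SchreierMem α ξ E → ξ < ω₁ →
      ∀ {F : Finset ℕ+}, F.Nonempty → E = insert z F → (∀ f ∈ F, f < y) →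
      insert y F ∈ schreier α ξ := by
    intro ξ E hE
    induction hE with
    | empty => intro _ F _ h; exact absurd h.symm (Finset.insert_ne_empty _ _)
    | singleton n =>
      intro _ F ⟨f, hf⟩ h hy
      have hz : z = n := by simpa using h.symm.subset (Finset.mem_insert_self _ _)
      have hf' : f = n := by simpa using h.symm.subset (Finset.mem_insert_of_mem hf)
      have := hy f hf
      exact absurd (hyz.trans_eq hz) (not_le.2 (hf' ▸ this))
    | succ γ n E mem le lt ih =>
      intro hξ F hF h hy
      have hγ : γ < ω₁ := (Order.lt_succ γ).trans hξ
      have hsub (i) (m) (hm : m ∈ E i) : m = z ∨ m ∈ F := by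
        have : m ∈ Finset.univ.biUnion E := Finset.mem_biUnion.2 ⟨i, Finset.mem_univ _, hm⟩
        simpa [h] using this
      -- The lower bound survives the move to the left because the nonempty `F` stays in front of
      -- `y`.
      have hn : ∀ m ∈ insert y F, n ≤ m := by
        have hnF : ∀ m ∈ F, n ≤ m := fun m hm => by
          have : m ∈ Finset.univ.biUnion E := h ▸ Finset.mem_insert_of_mem hm
          obtain ⟨i, -, hi⟩ := Finset.mem_biUnion.1 this
          exact le i m hi
        intro m hm
        rcases Finset.mem_insert.1 hm with rfl | hm
        · obtain ⟨f, hf⟩ := hF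
          exact (hnF f hf).trans (hy f hf).le
        · exact hnF m hm
      have hzE : z ∈ Finset.univ.biUnion E := h ▸ Finset.mem_insert_self _ _
      obtain ⟨i₀, -, hi₀⟩ := Finset.mem_biUnion.1 hzE
      have hFz : ∀ f ∈ F, f < z := fun f hf => (hy f hf).trans_le hyz
      -- Only the piece `i₀` containing `z` changes; if `z` was alone in it, the piece becomes a
      -- singleton.
      refine schreier_succ_iff.2 ⟨n, fun i => if i = i₀ then insert y ((E i).erase z) else
        (E i).erase z, fun i => ?_, hn, fun i j hij a ha b hb => ?_, ?_⟩
      · dsimp only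
        split_ifs with hi
        · subst hi
          rcases ((E i).erase z).eq_empty_or_nonempty with h0 | h0
          · rw [h0]; exact singleton_mem_schreier hα hγ y
          · refine ih i hγ h0 (Finset.insert_erase hi₀).symm fun f hf => ?_
            have := Finset.mem_erase.1 hf
            exact hy f ((hsub i f this.2).resolve_left this.1)
        · exact schreier_subset (mem i) (Finset.erase_subset _ _)
      · have hcases : ∀ i, ∀ a ∈ (if i = i₀ then insert y ((E i).erase z) else (E i).erase z),
            (a = y ∧ i = i₀) ∨ (a ∈ F ∧ a ∈ E i) := by
          intro i a ha
          have h2 : a ∈ (E i).erase z → a ∈ F ∧ a ∈ E i := fun h =>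
            ⟨(hsub i a (Finset.mem_erase.1 h).2).resolve_left (Finset.mem_erase.1 h).1,
              (Finset.mem_erase.1 h).2⟩
          split_ifs at ha with hi
          · rcases Finset.mem_insert.1 ha with rfl | ha
            exacts [Or.inl ⟨rfl, hi⟩, Or.inr (h2 ha)]
          · exact Or.inr (h2 ha)
        rcases hcases i a (by simpa using ha) with ⟨rfl, rfl⟩ | ⟨haF, hai⟩ <;>
          rcases hcases j b (by simpa using hb) with ⟨rfl, rfl⟩ | ⟨hbF, hbj⟩
        · exact absurd hij (lt_irrefl _)
        · exact absurd (lt i j hij z hi₀ b hbj) (hFz b hbF).not_gt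
        · exact hy a haF
        · exact lt i j hij a hai b hbj
      · ext m
        simp only [Finset.mem_insert, Finset.mem_biUnion, Finset.mem_univ, true_and]
        constructor
        · rintro (rfl | hm)
          · exact ⟨i₀, by simp⟩
          · have : m ∈ Finset.univ.biUnion E := h ▸ Finset.mem_insert_of_mem hm
            obtain ⟨i, -, hi⟩ := Finset.mem_biUnion.1 this
            refine ⟨i, ?_⟩
            split_ifs <;> simp [hi, (hFz m hm).ne]
        · rintro ⟨i, hi⟩
          split_ifs at hi with hii
          · rcases Finset.mem_insert.1 hi with rfl | hi
            · exact Or.inl rfl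
            · exact Or.inr ((hsub i m (Finset.mem_erase.1 hi).2).resolve_left
                (Finset.mem_erase.1 hi).1)
          · exact Or.inr ((hsub i m (Finset.mem_erase.1 hi).2).resolve_left
              (Finset.mem_erase.1 hi).1)
    | limit ζ hζ n E mem le ih =>
      intro hξ F hF h hy
      refine (schreier_limit_iff hζ).2 ⟨n, ih ((hα.lt ζ hξ hζ n).trans hξ) hF h hy, ?_⟩
      have hnF : ∀ m ∈ F, n ≤ m := fun m hm => le m (h ▸ Finset.mem_insert_of_mem hm)
      intro m hm
      rcases Finset.mem_insert.1 hm with rfl | hm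
      · obtain ⟨f, hf⟩ := hF
        exact (hnF f hf).trans (hy f hf).le
      · exact hnF m hm
  exact main hz hξ hF rfl hy

/-- This is the union property of `α` with `B = ∅`, applied repeatedly; it needs `1 < A`, whence `1
∉ A`. -/
theorem schreier_limit_mono (hα : IsApproximatingSystem α) (hξ : ξ < ω₁)
    (hl : Order.IsSuccLimit ξ) {A : Finset ℕ+} (h1 : 1 ∉ A) {m n : ℕ+} (hmn : m ≤ n)
    (hA : A ∈ schreier α (α ξ m)) : A ∈ schreier α (α ξ n) := by
  induction n using PNat.recOn with
  | one => rwa [le_antisymm hmn one_le] at hA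
  | succ n ih =>
    rcases hmn.eq_or_lt with rfl | h
    · exact hA
    · have hA' := ih (PNat.lt_add_one_iff.1 h)
      have := hα.union_mem ξ hξ hl n A ∅ hA'
        (empty_mem_schreier hα ((hα.lt ξ hξ hl n).trans hξ))
        (fun a ha b hb => by
          obtain rfl : a = 1 := ha
          exact lt_of_le_of_ne one_le fun h => h1 (h ▸ hb))
        (fun a _ b hb => by simp at hb)
      simpa using this

end Schreier

/-! ### Recutting interlaced Schreier sets: order zero and successor orders. -/

section Grouping

variable {α : Ordinal.{0} → ℕ+ → Ordinal.{0}} {ξ : Ordinal.{0}}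

/-- Each `A j` has at most one element, so distinct points of `P` come from distinct indices, and
numbering the points of `P` in increasing order already works. -/
theorem exists_grouping_zero {κ : Type} [DecidableEq κ] (J : Finset κ) (v : κ → ℕ+)
    (A : κ → Finset ℕ+) (hA : ∀ j, A j ∈ schreier α 0) (hv : ∀ j, ∀ n ∈ A j, v j ≤ n)
    (P : Finset ℕ+) (hP : ∀ p ∈ P, ∃ j ∈ J, p ∈ A j) :
    ∃ g : ℕ+ → ℕ, MonotoneOn g P ∧ (∀ p ∈ P, 1 ≤ g p ∧ g p ≤ (J.filter (v · ≤ p)).card) ∧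
      ∀ i, P.filter (g · = i) ∈ schreier α 0 := by
  have hlt {a b : ℕ+} (hb : b ∈ P) (hab : a < b) :
      (P.filter (· ≤ a)).card < (P.filter (· ≤ b)).card := by
    refine Finset.card_lt_card ⟨fun m hm => ?_, fun h => ?_⟩
    · simp only [Finset.mem_filter] at hm ⊢
      exact ⟨hm.1, hm.2.trans hab.le⟩
    · exact absurd (Finset.mem_filter.1 (h (Finset.mem_filter.2 ⟨hb, le_rfl⟩))).2 (not_le.2 hab)
  rcases P.eq_empty_or_nonempty with rfl | ⟨p₀, hp₀⟩
  · exact ⟨fun _ => 0, by simp [MonotoneOn], by simp, fun i => schreier_zero_iff.2 (by simp)⟩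
  obtain ⟨j₀, -⟩ := hP p₀ hp₀
  have : Nonempty κ := ⟨j₀⟩
  choose! c hcJ hcA using hP
  have hc : ∀ a ∈ P, ∀ b ∈ P, c a = c b → a = b := fun a ha b hb h => by
    have := Finset.card_le_one.1 (schreier_zero_iff.1 (hA (c b)))
    exact this a (h ▸ hcA a ha) b (hcA b hb)
  refine ⟨fun p => (P.filter (· ≤ p)).card, fun a _ b _ hab => ?_, fun p hp => ⟨?_, ?_⟩,
    fun i => schreier_zero_iff.2 (Finset.card_le_one.2 fun a ha b hb => ?_)⟩
  · exact Finset.card_le_card (Finset.monotone_filter_right _ fun m _ hm => hm.trans hab)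
  · exact Finset.card_pos.2 ⟨p, Finset.mem_filter.2 ⟨hp, le_rfl⟩⟩
  · refine Finset.card_le_card_of_injOn c (fun m hm => ?_) fun a ha b hb h => ?_
    · have hm := Finset.mem_filter.1 hm
      exact Finset.mem_filter.2 ⟨hcJ m hm.1, (hv _ _ (hcA m hm.1)).trans hm.2⟩
    · exact hc a (Finset.mem_filter.1 ha).1 b (Finset.mem_filter.1 hb).1 h
  · obtain ⟨ha, ha'⟩ := Finset.mem_filter.1 ha
    obtain ⟨hb, hb'⟩ := Finset.mem_filter.1 hb
    dsimp only at ha' hb'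
    rcases lt_trichotomy a b with h | h | h
    · have := hlt hb h; omega
    · exact h
    · have := hlt ha h; omega

/-- Consecutive groups of order `γ` are bundled into groups of order `γ + 1`, index `j` paying for
`n j` of them. For the index `a` with the largest `w a`, the groups numbered above `N` (the total
allowance of the others) are at most `n a` in number and start after `w a ≥ n a`, so they make one
set of order `γ + 1`; the groups up to `N` are left to the other indices. -/
theorem regroup_succ {γ : Ordinal.{0}} {κ : Type} [DecidableEq κ] (J : Finset κ)
    (w n : κ → ℕ+) (hn : ∀ j, n j ≤ w j) (P : Finset ℕ+) (h : ℕ+ → ℕ) (hmono : MonotoneOn h P)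
    (hpos : ∀ p ∈ P, 1 ≤ h p) (hle : ∀ p ∈ P, h p ≤ ∑ j ∈ J.filter (w · ≤ p), (n j : ℕ))
    (hfib : ∀ i, P.filter (h · = i) ∈ schreier α γ) :
    ∃ g : ℕ+ → ℕ, MonotoneOn g P ∧ (∀ p ∈ P, 1 ≤ g p ∧ g p ≤ (J.filter (w · ≤ p)).card) ∧
      ∀ i, i ≠ 0 → P.filter (g · = i) ∈ schreier α (Order.succ γ) := by
  induction J using Finset.induction_on_max_value w generalizing P with
  | empty =>
    have : P = ∅ := Finset.eq_empty_of_forall_notMem fun p hp => by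
      have h1 := hpos p hp
      have h2 := hle p hp
      simp at h2
      omega
    subst this
    refine ⟨fun _ => 0, by simp [MonotoneOn], by simp, fun i _ => ?_⟩
    exact schreier_succ_iff.2 ⟨1, fun _ => ∅, fun _ => by simpa using hfib 0, by simp,
      fun _ _ _ => by simp [SetLT], by ext; simp⟩
  | insert a s ha hmax ih =>
    set N := ∑ j ∈ s, (n j : ℕ) with hN
    have hsum (p) (hp : w a ≤ p) : (insert a s).filter (w · ≤ p) = insert a s :=
      Finset.filter_true_of_mem fun j hj => by
        rcases Finset.mem_insert.1 hj with rfl | hj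
        exacts [hp, (hmax j hj).trans hp]
    have hsum' (p) (hp : ¬ w a ≤ p) : (insert a s).filter (w · ≤ p) = s.filter (w · ≤ p) := by
      rw [Finset.filter_insert, if_neg hp]
    have hsN (p) : ∑ j ∈ s.filter (w · ≤ p), (n j : ℕ) ≤ N :=
      Finset.sum_le_sum_of_subset (Finset.filter_subset _ _)
    have hbig : ∀ p ∈ P, N < h p → w a ≤ p := fun p hp hlt => by
      by_contra hw
      have := hle p hp
      rw [hsum' p hw] at this
      have := hsN p
      omega
    obtain ⟨g, hg, hgle, hgfib⟩ := ih (P.filter (h · ≤ N))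
      (hmono.mono (Finset.coe_subset.2 (Finset.filter_subset _ _)))
      (fun p hp => hpos p (Finset.mem_filter.1 hp).1)
      (fun p hp => by
        obtain ⟨hp, hpN⟩ := Finset.mem_filter.1 hp
        by_cases hw : w a ≤ p
        · rw [Finset.filter_true_of_mem fun j hj => (hmax j hj).trans hw]
          exact hpN
        · have := hle p hp
          rwa [hsum' p hw] at this)
      (fun i => schreier_subset (hfib i) (Finset.filter_subset_filter _ (Finset.filter_subset _ _)))
    have hgs : ∀ p ∈ P, h p ≤ N → g p ≤ s.card := fun p hp hpN =>
      (hgle p (Finset.mem_filter.2 ⟨hp, hpN⟩)).2.trans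
        (Finset.card_le_card (Finset.filter_subset _ _))
    refine ⟨fun p => if h p ≤ N then g p else s.card + 1, fun p hp q hq hpq => ?_,
      fun p hp => ?_, fun i hi => ?_⟩
    · have := hmono hp hq hpq
      dsimp only
      split_ifs with h1 h2
      · exact hg (by simpa using ⟨hp, h1⟩) (by simpa using ⟨hq, h2⟩) hpq
      · exact (hgs p hp h1).trans (Nat.le_succ _)
      · omega
      · exact le_rfl
    · dsimp only
      split_ifs with h1
      · obtain ⟨h2, h3⟩ := hgle p (Finset.mem_filter.2 ⟨hp, h1⟩)
        exact ⟨h2, h3.trans (Finset.card_le_card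
          (Finset.filter_subset_filter _ (Finset.subset_insert _ _)))⟩
      · rw [hsum p (hbig p hp (not_le.1 h1)), Finset.card_insert_of_notMem ha]
        exact ⟨by omega, le_rfl⟩
    · by_cases hi' : i ≤ s.card
      · refine schreier_subset (hgfib i hi) fun p hp => ?_
        simp only [Finset.mem_filter] at hp ⊢
        split_ifs at hp with h1
        · exact ⟨⟨hp.1, h1⟩, hp.2⟩
        · omega
      · have hT : ∀ p ∈ P.filter (fun p => (if h p ≤ N then g p else s.card + 1) = i),
            p ∈ P ∧ N < h p ∧ h p ≤ N + n a := fun p hp => by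
          obtain ⟨hp, hpi⟩ := Finset.mem_filter.1 hp
          split_ifs at hpi with h1
          · have := hgs p hp h1
            omega
          · refine ⟨hp, not_le.1 h1, (hle p hp).trans ?_⟩
            rw [hsum p (hbig p hp (not_le.1 h1)), Finset.sum_insert ha, add_comm]
        refine schreier_subset (E := P.filter fun p => N < h p ∧ h p ≤ N + n a) ?_ fun p hp =>
          Finset.mem_filter.2 (hT p hp)
        refine schreier_succ_iff.2 ⟨n a, fun j => P.filter (h · = N + 1 + (j : ℕ)),
          fun j => hfib _, fun p hp => ?_, fun j k hjk p hp q hq => ?_, ?_⟩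
        · obtain ⟨hp, h1, -⟩ := Finset.mem_filter.1 hp
          exact (hn a).trans (hbig p hp h1)
        · simp only [Finset.coe_filter, Set.mem_ofPred_eq] at hp hq
          by_contra! hqp
          have := hmono hq.1 hp.1 hqp
          have : (j : ℕ) < k := hjk
          omega
        · ext p
          simp only [Finset.mem_filter, Finset.mem_biUnion, Finset.mem_univ, true_and]
          constructor
          · rintro ⟨hp, h1, h2⟩
            exact ⟨⟨h p - (N + 1), by omega⟩, hp, by simp only; omega⟩
          · rintro ⟨j, hp, hj⟩
            have := j.2
            exact ⟨hp, by omega, by omega⟩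

theorem exists_grouping_succ {γ : Ordinal.{0}}
    (ih : ∀ {κ : Type} [DecidableEq κ] (J : Finset κ) (v : κ → ℕ+)
      (A : κ → Finset ℕ+), (∀ j, A j ∈ schreier α γ) → (∀ j, ∀ n ∈ A j, v j ≤ n) →
      ∀ (P : Finset ℕ+), (∀ p ∈ P, ∃ j ∈ J, p ∈ A j) →
      ∃ g : ℕ+ → ℕ, MonotoneOn g P ∧ (∀ p ∈ P, 1 ≤ g p ∧ g p ≤ (J.filter (v · ≤ p)).card) ∧
        ∀ i, P.filter (g · = i) ∈ schreier α γ)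
    {κ : Type} [DecidableEq κ] (J : Finset κ) (v : κ → ℕ+)
    (A : κ → Finset ℕ+) (hA : ∀ j, A j ∈ schreier α (Order.succ γ))
    (hv : ∀ j, ∀ n ∈ A j, v j ≤ n) (P : Finset ℕ+) (hP : ∀ p ∈ P, ∃ j ∈ J, p ∈ A j) :
    ∃ g : ℕ+ → ℕ, MonotoneOn g P ∧ (∀ p ∈ P, 1 ≤ g p ∧ g p ≤ (J.filter (v · ≤ p)).card) ∧
      ∀ i, i ≠ 0 → P.filter (g · = i) ∈ schreier α (Order.succ γ) := by
  choose n E hE hn _ hAE using fun j => schreier_succ_iff.1 (hA j)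
  -- Starting points are raised to at least `n j`, so that `n j` groups beginning after `w j` may be
  -- bundled.
  let w : κ → ℕ+ := fun j => max (v j) (n j)
  have hw : ∀ j, ∀ p ∈ A j, w j ≤ p := fun j p hp => max_le (hv j p hp) (hn j p hp)
  have hEA : ∀ j i, E j i ⊆ A j := fun j i p hp => by
    rw [hAE j]
    exact Finset.mem_biUnion.2 ⟨i, Finset.mem_univ _, hp⟩
  obtain ⟨h, hmono, hle, hfib⟩ := ih (κ := Σ j, Fin (n j)) (J.sigma fun _ => Finset.univ)
    (fun x => w x.1) (fun x => E x.1 x.2) (fun x => hE _ _) (fun x p hp => hw _ p (hEA _ _ hp)) P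
    (fun p hp => by
      obtain ⟨j, hj, hpj⟩ := hP p hp
      rw [hAE j] at hpj
      obtain ⟨i, -, hi⟩ := Finset.mem_biUnion.1 hpj
      exact ⟨⟨j, i⟩, by simp [hj], hi⟩)
  obtain ⟨g, hg, hgle, hgfib⟩ := regroup_succ J w n (fun j => le_max_right _ _) P h hmono
    (fun p hp => (hle p hp).1) (fun p hp => by
      refine (hle p hp).2.trans (le_of_eq ?_)
      have : (J.sigma fun j => (Finset.univ : Finset (Fin (n j)))).filter (fun x => w x.1 ≤ p) =
          (J.filter (w · ≤ p)).sigma fun j => Finset.univ := by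
        ext x; simp
      rw [this, Finset.card_sigma]
      simp) hfib
  refine ⟨g, hg, fun p hp => ⟨(hgle p hp).1, (hgle p hp).2.trans ?_⟩, hgfib⟩
  exact Finset.card_le_card (Finset.monotone_filter_right _ fun j _ hj => (le_max_left _ _).trans hj)

end Grouping

/-! ### Recutting interlaced Schreier sets: limit orders. -/

section GroupingLimit

variable {α : Ordinal.{0} → ℕ+ → Ordinal.{0}} {ξ : Ordinal.{0}}

/-- Every finite subset of `⋃ j ∈ J, A j`, where `A j ∈ 𝓕` and `v j ≤ A j`, is a union of successive
members of `𝓕`, the `i`-th of which starts after `i` of the numbers `v j`. -/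
def HasGrouping (𝓕 : Set (Finset ℕ+)) : Prop :=
  ∀ {κ : Type} [DecidableEq κ] (J : Finset κ) (v : κ → ℕ+) (A : κ → Finset ℕ+),
    (∀ j, A j ∈ 𝓕) → (∀ j, ∀ n ∈ A j, v j ≤ n) →
    ∀ (P : Finset ℕ+), (∀ p ∈ P, ∃ j ∈ J, p ∈ A j) →
    ∃ g : ℕ+ → ℕ, MonotoneOn g P ∧ (∀ p ∈ P, 1 ≤ g p ∧ g p ≤ (J.filter (v · ≤ p)).card) ∧
      ∀ i, P.filter (g · = i) ∈ 𝓕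

/-- Two members of `𝓢_{α ξ m}` have a union in `𝓢_ξ` once their elements exceed `m`. -/
theorem union_mem_schreier_limit (hα : IsApproximatingSystem α) (hξ : ξ < ω₁)
    (hl : Order.IsSuccLimit ξ) {m : ℕ+} (hm : HasGrouping (schreier α (α ξ m)))
    {A B : Finset ℕ+} (hA : A ∈ schreier α (α ξ m)) (hB : B ∈ schreier α (α ξ m))
    (h : ∀ p ∈ A ∪ B, m < p) : A ∪ B ∈ schreier α ξ := by
  -- `A` and `B` may interlace; grouping the pair first makes them successive, as the union property
  -- requires.
  obtain ⟨g, hg, hgle, hgfib⟩ := hm (κ := Bool) Finset.univ (fun _ => 1)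
    (fun b => if b then A else B) (fun b => by split_ifs <;> assumption)
    (fun _ _ _ => one_le) (A ∪ B) (fun p hp => by
      rcases Finset.mem_union.1 hp with hp | hp
      exacts [⟨true, by simp, by simpa using hp⟩, ⟨false, by simp, by simpa using hp⟩])
  have hg2 : ∀ p ∈ A ∪ B, g p = 1 ∨ g p = 2 := fun p hp => by
    obtain ⟨h1, h2⟩ := hgle p hp
    have : (Finset.univ.filter fun _ : Bool => (1 : ℕ+) ≤ p).card ≤ 2 :=
      Finset.card_le_univ _
    omega
  have hu := hα.union_mem ξ hξ hl m _ _ (hgfib 1) (hgfib 2)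
    (fun a ha b hb => by
      obtain rfl : a = 1 := ha
      simp only [Finset.coe_filter, Set.mem_ofPred_eq] at hb
      exact lt_of_le_of_lt one_le (h b hb.1))
    (fun a ha b hb => by
      simp only [Finset.coe_filter, Set.mem_ofPred_eq] at ha hb
      by_contra! hba
      have := hg hb.1 ha.1 hba
      omega)
  rw [← Finset.filter_or, Finset.filter_true_of_mem hg2] at hu
  exact (schreier_limit_iff hl).2 ⟨m + 1, hu, fun p hp => PNat.add_one_le_iff.2 (h p hp)⟩

/-- Induction on the number of indices: one index is spent on an initial group. The set `A j₁`
covers `P` up to the first point `p₂` that belongs to another set `A j₂`. If `A j₁` continues beyond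
`p₂`, its remainder is merged into that of `A j₂`; beyond `p₂` the union of the two is still of
order `ξ`, because both have elements at or before `p₂`. -/
theorem HasGrouping.limit (hα : IsApproximatingSystem α) (hξ : ξ < ω₁)
    (hl : Order.IsSuccLimit ξ) (hm : ∀ m, HasGrouping (schreier α (α ξ m))) :
    HasGrouping (schreier α ξ) := by
  intro κ _ J v A hA hv P hP
  have he := empty_mem_schreier hα hξ
  induction hc : J.card using Nat.strong_induction_on generalizing J A P with
  | _ c ih =>
  subst hc
  rcases P.eq_empty_or_nonempty with rfl | ⟨p₀, hp₀⟩
  · exact ⟨fun _ => 0, by simp [MonotoneOn], by simp, fun i => by simpa using he⟩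
  have hrec := fun (j₁ : κ) (hj₁ : j₁ ∈ J) => ih _ (Finset.card_erase_lt_of_mem hj₁)
  -- The first group consists of the elements of `P` below a threshold.
  have prepend : ∀ (q : ℕ+ → Prop) [DecidablePred q], (∀ a b, a ≤ b → q b → q a) →
      ∀ j₁ ∈ J, (∀ p ∈ P, v j₁ ≤ p) → P.filter q ∈ schreier α ξ →
      (∃ g : ℕ+ → ℕ, MonotoneOn g (P.filter (¬ q ·)) ∧ (∀ p ∈ P.filter (¬ q ·), 1 ≤ g p ∧
        g p ≤ ((J.erase j₁).filter (v · ≤ p)).card) ∧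
        ∀ i, (P.filter (¬ q ·)).filter (g · = i) ∈ schreier α ξ) →
      ∃ g : ℕ+ → ℕ, MonotoneOn g P ∧ (∀ p ∈ P, 1 ≤ g p ∧ g p ≤ (J.filter (v · ≤ p)).card) ∧
        ∀ i, P.filter (g · = i) ∈ schreier α ξ := by
    rintro q _ hq j₁ hj₁ hvj hB ⟨g, hg, hgle, hgfib⟩
    refine ⟨fun p => if q p then 1 else g p + 1, fun a ha b hb hab => ?_, fun p hp => ?_,
      fun i => ?_⟩
    · dsimp only
      split_ifs with h1 h2 h2
      · exact le_rfl
      · omega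
      · exact absurd (hq a b hab h2) h1
      · exact Nat.succ_le_succ (hg (by simpa using ⟨ha, h1⟩) (by simpa using ⟨hb, h2⟩) hab)
    · have hmem : j₁ ∈ J.filter (v · ≤ p) := Finset.mem_filter.2 ⟨hj₁, hvj p hp⟩
      dsimp only
      split_ifs with h1
      · exact ⟨le_rfl, Finset.card_pos.2 ⟨j₁, hmem⟩⟩
      · obtain ⟨h2, h3⟩ := hgle p (Finset.mem_filter.2 ⟨hp, h1⟩)
        rw [Finset.filter_erase, Finset.card_erase_of_mem hmem] at h3
        have := Finset.card_pos.2 ⟨j₁, hmem⟩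
        omega
    · by_cases hi : i = 1
      · refine schreier_subset hB fun p hp => ?_
        obtain ⟨hp, hpi⟩ := Finset.mem_filter.1 hp
        dsimp only at hpi
        split_ifs at hpi with h1
        · exact Finset.mem_filter.2 ⟨hp, h1⟩
        · have := (hgle p (Finset.mem_filter.2 ⟨hp, h1⟩)).1
          omega
      · refine schreier_subset (hgfib (i - 1)) fun p hp => ?_
        obtain ⟨hp, hpi⟩ := Finset.mem_filter.1 hp
        dsimp only at hpi
        split_ifs at hpi with h1
        · exact absurd hpi.symm hi
        · exact Finset.mem_filter.2 ⟨Finset.mem_filter.2 ⟨hp, h1⟩, by omega⟩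
  -- The first index.
  obtain ⟨j₁, hj₁, hp₁⟩ := hP (P.min' ⟨p₀, hp₀⟩) (Finset.min'_mem _ _)
  set p₁ := P.min' ⟨p₀, hp₀⟩ with hp₁def
  have hp₁P : p₁ ∈ P := Finset.min'_mem _ _
  have hp₁le : ∀ p ∈ P, p₁ ≤ p := fun p hp => Finset.min'_le _ _ hp
  have hvj₁ : ∀ p ∈ P, v j₁ ≤ p := fun p hp => (hv j₁ _ hp₁).trans (hp₁le p hp)
  by_cases hR : ∀ p ∈ P, p ∈ A j₁
  · exact prepend (fun _ => True) (fun _ _ _ _ => trivial) j₁ hj₁ hvj₁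
      (schreier_subset (hA j₁) fun p hp => hR p (Finset.mem_filter.1 hp).1)
      (hrec j₁ hj₁ _ A hA hv _ (by simp) rfl)
  -- The second index: it contains the first element that is not covered by the first index.
  by_cases hcov : ∀ p ∈ P, ∃ j ∈ J.erase j₁, p ∈ A j
  · obtain ⟨g, hg, hgle, hgfib⟩ := hrec j₁ hj₁ _ A hA hv P hcov rfl
    exact ⟨g, hg, fun p hp => ⟨(hgle p hp).1, (hgle p hp).2.trans
      (Finset.card_le_card (Finset.filter_subset_filter _ (Finset.erase_subset _ _)))⟩, hgfib⟩
  set Q := P.filter fun p => ∃ j ∈ J.erase j₁, p ∈ A j with hQ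
  have hQne : Q.Nonempty := by
    push Not at hR
    obtain ⟨p, hp, hpA⟩ := hR
    obtain ⟨j, hj, hpj⟩ := hP p hp
    exact ⟨p, Finset.mem_filter.2 ⟨hp, j, Finset.mem_erase.2 ⟨fun h => hpA (h ▸ hpj), hj⟩, hpj⟩⟩
  obtain ⟨hp₂P, j₂, hj₂, hp₂⟩ := Finset.mem_filter.1 (Q.min'_mem hQne)
  set p₂ := Q.min' hQne with hp₂def
  have hp₂le : ∀ p ∈ P, ∀ j ∈ J.erase j₁, p ∈ A j → p₂ ≤ p := fun p hp j hj hpj =>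
    Finset.min'_le _ _ (Finset.mem_filter.2 ⟨hp, j, hj, hpj⟩)
  have hbelow : ∀ p ∈ P, p < p₂ → p ∈ A j₁ := fun p hp hlt => by
    obtain ⟨j, hj, hpj⟩ := hP p hp
    by_cases h : j = j₁
    · exact h ▸ hpj
    · exact absurd (hp₂le p hp j (Finset.mem_erase.2 ⟨h, hj⟩) hpj) (not_le.2 hlt)
  by_cases hz : ∃ z ∈ P, z ∈ A j₁ ∧ p₂ ≤ z
  swap
  · push Not at hz
    refine prepend (· < p₂) (fun a b hab hb => hab.trans_lt hb) j₁ hj₁ hvj₁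
      (schreier_subset (hA j₁) fun p hp => hbelow p (Finset.mem_filter.1 hp).1
        (Finset.mem_filter.1 hp).2)
      (hrec j₁ hj₁ _ A hA hv _ (fun p hp => ?_) rfl)
    obtain ⟨hpP, hlt⟩ := Finset.mem_filter.1 hp
    obtain ⟨j, hj, hpj⟩ := hP p hpP
    refine ⟨j, Finset.mem_erase.2 ⟨?_, hj⟩, hpj⟩
    rintro rfl
    exact hlt (hz p hpP hpj)
  obtain ⟨z, hzP, hzA, hz⟩ := hz
  -- If `1 ∈ P`, then `A j₁` is `{1}` and `p₂ = 1`, so the other indices cover `P`, a case already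
  -- settled.
  have h1 : 1 ∉ P := by
    intro h1
    have h11 : p₁ = 1 := le_antisymm (hp₁le 1 h1) one_le
    have hone := eq_one_of_one_mem_schreier (hA j₁) (h11 ▸ hp₁)
    have h12 : p₂ = 1 := le_antisymm (hz.trans_eq (hone z hzA)) one_le
    refine hcov fun p hp => ?_
    obtain ⟨j, hj, hpj⟩ := hP p hp
    by_cases h : j = j₁
    · subst h
      rw [hone p hpj, ← h12]
      exact ⟨j₂, hj₂, hp₂⟩
    · exact ⟨j, Finset.mem_erase.2 ⟨h, hj⟩, hpj⟩
  -- The approximating index of a set is bounded by its elements, hence by `p₂`.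
  have hlow : ∀ j, (∃ p ∈ P, p ∈ A j ∧ p ≤ p₂) → A j ∩ P ∈ schreier α (α ξ p₂) := by
    rintro j ⟨p, hp, hpj, hle⟩
    obtain ⟨n, hn, hnle⟩ := (schreier_limit_iff hl).1 (hA j)
    exact schreier_limit_mono hα hξ hl (fun h => h1 (Finset.mem_inter.1 h).2)
      ((hnle p hpj).trans hle) (schreier_subset hn Finset.inter_subset_left)
  have hunion : ((A j₁ ∪ A j₂) ∩ P).filter (p₂ < ·) ∈ schreier α ξ := by
    rw [Finset.union_inter_distrib_right, Finset.filter_union]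
    refine union_mem_schreier_limit hα hξ hl (hm p₂)
      (schreier_subset (hlow j₁ ⟨p₁, hp₁P, hp₁, hp₁le _ hp₂P⟩) (Finset.filter_subset _ _))
      (schreier_subset (hlow j₂ ⟨p₂, hp₂P, hp₂, le_rfl⟩) (Finset.filter_subset _ _)) fun p hp => ?_
    rw [← Finset.filter_union] at hp
    exact (Finset.mem_filter.1 hp).2
  -- Below `p₂` this is part of `A j₁`; the point `p₂` takes the place of the later element `z` of
  -- `A j₁`.
  have hfirst : P.filter (· ≤ p₂) ∈ schreier α ξ := by
    have hsub : P.filter (· ≤ p₂) ⊆ insert p₂ (P.filter (· < p₂)) := fun p hp => by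
      obtain ⟨hp, hle⟩ := Finset.mem_filter.1 hp
      rcases hle.eq_or_lt with rfl | h
      · exact Finset.mem_insert_self _ _
      · exact Finset.mem_insert_of_mem (Finset.mem_filter.2 ⟨hp, h⟩)
    refine schreier_subset ?_ hsub
    rcases (P.filter (· < p₂)).eq_empty_or_nonempty with h0 | h0
    · rw [h0]
      exact singleton_mem_schreier hα hξ p₂
    · refine insert_mem_schreier_of_le hα hξ h0 (schreier_subset (hA j₁) fun p hp => ?_)
        (fun p hp => (Finset.mem_filter.1 hp).2) hz
      rcases Finset.mem_insert.1 hp with rfl | hp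
      · exact hzA
      · exact hbelow p (Finset.mem_filter.1 hp).1 (Finset.mem_filter.1 hp).2
  refine prepend (· ≤ p₂) (fun a b hab hb => hab.trans hb) j₁ hj₁ hvj₁ hfirst
    (hrec j₁ hj₁ _ (fun j => if j = j₂ then ((A j₁ ∪ A j₂) ∩ P).filter (p₂ < ·) else A j)
      (fun j => by split_ifs <;> [exact hunion; exact hA j])
      (fun j p hp => ?_) _ (fun p hp => ?_) rfl)
  · split_ifs at hp with h
    · subst h
      exact (hv j _ hp₂).trans (Finset.mem_filter.1 hp).2.le
    · exact hv j p hp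
  · obtain ⟨hp, hlt⟩ := Finset.mem_filter.1 hp
    obtain ⟨j, hj, hpj⟩ := hP p hp
    by_cases h : j = j₁ ∨ j = j₂
    · refine ⟨j₂, hj₂, ?_⟩
      rw [if_pos rfl]
      refine Finset.mem_filter.2 ⟨Finset.mem_inter.2 ⟨?_, hp⟩, not_le.1 hlt⟩
      rcases h with rfl | rfl
      exacts [Finset.mem_union_left _ hpj, Finset.mem_union_right _ hpj]
    · push Not at h
      exact ⟨j, Finset.mem_erase.2 ⟨h.1, hj⟩, by rwa [if_neg h.2]⟩

theorem hasGrouping_schreier (hα : IsApproximatingSystem α) (hξ : ξ < ω₁) :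
    HasGrouping (schreier α ξ) := by
  induction ξ using WellFoundedLT.induction with
  | _ ξ ih =>
  rcases Ordinal.zero_or_succ_or_isSuccLimit ξ with rfl | ⟨γ, rfl⟩ | hl
  · exact exists_grouping_zero
  · intro κ _ J v A hA hv P hP
    obtain ⟨g, hg, hgle, hgfib⟩ := exists_grouping_succ
      (ih γ (Order.lt_succ γ) ((Order.lt_succ γ).trans hξ)) J v A hA hv P hP
    refine ⟨g, hg, hgle, fun i => ?_⟩
    rcases eq_or_ne i 0 with rfl | hi
    · rw [Finset.filter_false_of_mem fun p hp => (Nat.one_le_iff_ne_zero.1 (hgle p hp).1)]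
      exact empty_mem_schreier hα hξ
    · exact hgfib i hi
  · exact HasGrouping.limit hα hξ hl fun m =>
      ih _ (hα.lt ξ hξ hl m) ((hα.lt ξ hξ hl m).trans hξ)

end GroupingLimit

/-! ### Counting functions and enumerations of finite sets. -/

section Counting

variable {α : Ordinal.{0} → ℕ+ → Ordinal.{0}} {ξ : Ordinal.{0}}

/-- The number of elements of `P` that are at most `n`. -/
def countLE (P : Finset ℕ+) (n : ℕ+) : ℕ := (P.filter (· ≤ n)).card

theorem countLE_mono (P : Finset ℕ+) : Monotone (countLE P) := fun _ _ hab =>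
  Finset.card_le_card (Finset.monotone_filter_right _ fun _ _ hm => hm.trans hab)

theorem countLE_le_card (P : Finset ℕ+) (n : ℕ+) : countLE P n ≤ P.card :=
  Finset.card_le_card (Finset.filter_subset _ _)

theorem countLE_pos {P : Finset ℕ+} {p n : ℕ+} (hp : p ∈ P) (hpn : p ≤ n) : 0 < countLE P n :=
  Finset.card_pos.2 ⟨p, Finset.mem_filter.2 ⟨hp, hpn⟩⟩

theorem countLE_lt {P : Finset ℕ+} {a b : ℕ+} (hb : b ∈ P) (hab : a < b) :
    countLE P a < countLE P b := by
  refine Finset.card_lt_card ⟨fun m hm => ?_, fun h => ?_⟩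
  · simp only [Finset.mem_filter] at hm ⊢
    exact ⟨hm.1, hm.2.trans hab.le⟩
  · exact absurd (Finset.mem_filter.1 (h (Finset.mem_filter.2 ⟨hb, le_rfl⟩))).2 (not_le.2 hab)

theorem countLE_union {P Q : Finset ℕ+} (h : Disjoint P Q) (n : ℕ+) :
    countLE (P ∪ Q) n = countLE P n + countLE Q n := by
  unfold countLE
  rw [Finset.filter_union, Finset.card_union_of_disjoint]
  exact Finset.disjoint_filter_filter h

/-- The increasing enumeration `q 1 < q 2 < ⋯` of a finite set. -/
theorem exists_enumeration (P : Finset ℕ+) : ∃ q : ℕ → ℕ+,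
    (∀ j, 1 ≤ j → j ≤ P.card → q j ∈ P) ∧
    (∀ i j, 1 ≤ i → i < j → j ≤ P.card → q i < q j) ∧
    ∀ j n, 1 ≤ j → j ≤ countLE P n → q j ≤ n := by
  set q : ℕ → ℕ+ := fun j => if h : j - 1 < P.card then P.orderEmbOfFin rfl ⟨j - 1, h⟩ else 1
    with hq
  have hqval (j) (h : j - 1 < P.card) : q j = P.orderEmbOfFin rfl ⟨j - 1, h⟩ := by
    simp [hq, h]
  have hlt : ∀ i j, 1 ≤ i → i < j → j ≤ P.card → q i < q j := fun i j hi hij hj => by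
    rw [hqval i (by omega), hqval j (by omega)]
    refine (P.orderEmbOfFin rfl).strictMono (Fin.mk_lt_mk.2 (by omega))
  refine ⟨q, fun j h1 hj => ?_, hlt, fun j n h1 hj => ?_⟩
  · rw [hqval j (by omega)]
    exact Finset.orderEmbOfFin_mem _ _ _
  · by_contra! hn
    have hjc := hj.trans (countLE_le_card P n)
    have hsub : P.filter (· ≤ n) ⊆ (Finset.Icc 1 (j - 1)).image q := fun p hp => by
      obtain ⟨hpP, hpn⟩ := Finset.mem_filter.1 hp
      have : p ∈ Set.range (P.orderEmbOfFin rfl) := by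
        rw [Finset.range_orderEmbOfFin]; exact hpP
      obtain ⟨⟨i, hi⟩, rfl⟩ := this
      refine Finset.mem_image.2 ⟨i + 1, Finset.mem_Icc.2 ⟨by omega, ?_⟩, hqval (i + 1) hi⟩
      by_contra! hij
      have h2 : P.orderEmbOfFin rfl ⟨i, hi⟩ < P.orderEmbOfFin rfl ⟨j - 1, by omega⟩ := by
        rw [← hqval j (by omega)]; exact hpn.trans_lt hn
      have := (P.orderEmbOfFin rfl).lt_iff_lt.1 h2
      rw [Fin.mk_lt_mk] at this
      omega
    have := (Finset.card_le_card hsub).trans Finset.card_image_le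
    rw [Nat.card_Icc] at this
    have h3 : j ≤ (P.filter (· ≤ n)).card := hj
    omega

/-- Sending the `i`-th element of `F` to the `i`-th element of `E` moves it to the left. -/
theorem schreier_spread_of_countLE {E F : Finset ℕ+} (hE : E ∈ schreier α ξ)
    (h : ∀ n, countLE F n ≤ countLE E n) : F ∈ schreier α ξ := by
  obtain ⟨q, hq, hqlt, hqle⟩ := exists_enumeration E
  have hcard (n) : countLE F n ≤ E.card := (h n).trans (countLE_le_card _ _)
  refine schreier_spread hE (fun n => q (countLE F n)) (fun a ha b hb hab => ?_) (fun n hn => ?_)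
    fun n hn => ?_
  · exact hqlt _ _ (countLE_pos ha le_rfl) (countLE_lt hb hab) (hcard b)
  · exact hq _ (countLE_pos hn le_rfl) (hcard n)
  · exact hqle _ _ (countLE_pos hn le_rfl) (h n)

end Counting

/-! ### Functionals bounded by the Tsirelson norm. -/

section Dominated

variable {𝓕 : Set (Finset ℕ+)} {θ : ℝ}

/-- The functional with the nonnegative coefficients `w` on `G` is bounded by the Tsirelson norm. -/
def Dominated (𝓕 : Set (Finset ℕ+)) (θ : ℝ) (w : ℕ+ → ℝ) (G : Finset ℕ+) : Prop :=
  ∀ x : ℕ+ →₀ ℝ, ∑ n ∈ G, w n * |x n| ≤ tsirelsonNorm 𝓕 θ x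

theorem Dominated.mono {w : ℕ+ → ℝ} (hw : ∀ n, 0 ≤ w n) {G H : Finset ℕ+}
    (h : Dominated 𝓕 θ w H) (hGH : G ⊆ H) : Dominated 𝓕 θ w G := fun x =>
  (Finset.sum_le_sum_of_subset_of_nonneg hGH fun n _ _ =>
    mul_nonneg (hw n) (abs_nonneg _)).trans (h x)

theorem dominated_empty (w : ℕ+ → ℝ) : Dominated 𝓕 θ w ∅ := fun x => by
  simpa using tsirelsonNorm_nonneg x

theorem Dominated.congr {w w' : ℕ+ → ℝ} {G : Finset ℕ+} (h : Dominated 𝓕 θ w G)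
    (hw : ∀ n ∈ G, w' n = w n) : Dominated 𝓕 θ w' G := fun x => by
  rw [Finset.sum_congr rfl fun n hn => by rw [hw n hn]]
  exact h x

theorem dominated_singleton (hθ : θ ≤ 1) {w : ℕ+ → ℝ} (n : ℕ+) (hw : w n = 1) :
    Dominated 𝓕 θ w {n} := fun x => by
  simpa [hw] using abs_apply_le_tsirelsonNorm hθ x n

/-- An admissible sequence of dominated functionals, given by the fibres of a monotone function
`u`, combines to a dominated functional. -/
theorem Dominated.combine (hθ : 0 < θ) (hθ' : θ ≤ 1) {w : ℕ+ → ℝ} {G : Finset ℕ+} {u : ℕ+ → ℕ}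
    (hu : MonotoneOn u G) (hT : G.filter (fun n => ∀ m ∈ G, m < n → u m ≠ u n) ∈ 𝓕)
    (h : ∀ i, Dominated 𝓕 θ w (G.filter (u · = i))) :
    Dominated 𝓕 θ (fun n => θ * w n) G := by
  intro x
  set T := G.filter (fun n => ∀ m ∈ G, m < n → u m ≠ u n) with hTdef
  have hTmem {n} : n ∈ T ↔ n ∈ G ∧ ∀ m ∈ G, m < n → u m ≠ u n := Finset.mem_filter
  set t : Fin T.card → ℕ+ := fun i => T.orderEmbOfFin rfl i
  have htT (i) : t i ∈ T := Finset.orderEmbOfFin_mem _ _ _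
  have htG (i) : t i ∈ G := (hTmem.1 (htT i)).1
  have htlt {i j} (hij : i < j) : t i < t j := (T.orderEmbOfFin rfl).strictMono hij
  have hut {i j} (hij : i < j) : u (t i) < u (t j) :=
    lt_of_le_of_ne (hu (htG i) (htG j) (htlt hij).le) ((hTmem.1 (htT j)).2 _ (htG i) (htlt hij))
  have hutinj : Function.Injective fun i => u (t i) := fun i j hij => by
    rcases lt_trichotomy i j with h | h | h
    · exact absurd hij (hut h).ne
    · exact h
    · exact absurd hij (hut h).ne'
  set E : Fin T.card → Finset ℕ+ := fun i => G.filter (u · = u (t i)) with hE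
  have hEmem {i n} : n ∈ E i ↔ n ∈ G ∧ u n = u (t i) := Finset.mem_filter
  have hadm : IsAdmissible 𝓕 fun i => (E i : Set ℕ+) := by
    refine ⟨fun i j hij a ha b hb => ?_, t, fun i => ⟨?_, fun a ha => ?_⟩, ?_⟩
    · obtain ⟨ha, ha'⟩ := hEmem.1 (Finset.mem_coe.1 ha)
      obtain ⟨hb, hb'⟩ := hEmem.1 (Finset.mem_coe.1 hb)
      by_contra! hba
      have := hu hb ha hba
      have := hut hij
      omega
    · exact Finset.mem_coe.2 (hEmem.2 ⟨htG i, rfl⟩)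
    · obtain ⟨ha, ha'⟩ := hEmem.1 (Finset.mem_coe.1 ha)
      by_contra! hlt
      exact (hTmem.1 (htT i)).2 a ha hlt ha'
    · have : Finset.univ.image t = T := by
        ext n
        refine ⟨fun hn => ?_, fun hn => ?_⟩
        · obtain ⟨i, -, rfl⟩ := Finset.mem_image.1 hn
          exact htT i
        · have hn' : n ∈ Set.range (T.orderEmbOfFin rfl) := by
            rw [Finset.range_orderEmbOfFin]; exact hn
          obtain ⟨i, hi⟩ := hn'
          exact Finset.mem_image.2 ⟨i, Finset.mem_univ _, hi⟩
      rw [this]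
      exact hT
  refine le_trans ?_ (mul_le_tsirelsonNorm hθ hθ' x _ ⟨T.card, E, hadm, rfl⟩)
  simp only [mul_assoc]
  rw [← Finset.mul_sum]
  refine mul_le_mul_of_nonneg_left ?_ hθ.le
  have hmaps : ∀ n ∈ G, u n ∈ Finset.univ.image fun i => u (t i) := fun n hn => by
    have hne : (G.filter (u · = u n)).Nonempty := ⟨n, Finset.mem_filter.2 ⟨hn, rfl⟩⟩
    obtain ⟨hmG, hmu⟩ := Finset.mem_filter.1 (Finset.min'_mem _ hne)
    have hmT : (G.filter (u · = u n)).min' hne ∈ T := hTmem.2 ⟨hmG, fun m hm hlt heq =>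
      absurd (Finset.min'_le _ m (Finset.mem_filter.2 ⟨hm, heq.trans hmu⟩)) (not_le.2 hlt)⟩
    have : (G.filter (u · = u n)).min' hne ∈ Set.range (T.orderEmbOfFin rfl) := by
      rw [Finset.range_orderEmbOfFin]; exact hmT
    obtain ⟨i, hi⟩ := this
    exact Finset.mem_image.2 ⟨i, Finset.mem_univ _, (congrArg u hi).trans hmu⟩
  rw [← Finset.sum_fiberwise_of_maps_to hmaps, Finset.sum_image fun i _ j _ hij => hutinj hij]
  refine Finset.sum_le_sum fun i _ => le_trans (le_of_eq (Finset.sum_congr rfl fun n hn => ?_))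
    (h (u (t i)) (proj (E i) x))
  have : proj (E i) x n = x n := Finsupp.filter_apply_pos (· ∈ E i) x hn
  rw [this]

end Dominated

/-! ### Schemes, and straightening them level by level. -/

/-- A bookkeeping of the tree of a functional in the norming set of the modified Tsirelson space:
`L` are the leaves, `δ` is their depth, and `I e` are the first elements of the inner nodes of
depth `e`; everything takes place in the set `X`. -/
structure IsScheme (𝓕 : Set (Finset ℕ+)) (X L : Finset ℕ+) (δ : ℕ+ → ℕ) (I : ℕ → Finset ℕ+) :
    Prop where
  leaf_subset : L ⊆ X
  node_subset : ∀ e, I e ⊆ X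
  notMem_node : ∀ n ∈ L, n ∉ I (δ n)
  root : (I 0 ∪ L.filter (δ · = 0)).card ≤ 1
  children : ∀ e, ∃ A : ℕ+ → Finset ℕ+, (∀ v, A v ∈ 𝓕 ∧ ∀ n ∈ A v, v ≤ n) ∧
    ∀ p ∈ I (e + 1) ∪ L.filter (δ · = e + 1), ∃ v ∈ I e, p ∈ A v

namespace IsScheme

variable {α : Ordinal.{0} → ℕ+ → Ordinal.{0}} {ξ : Ordinal.{0}} {θ : ℝ}
  {X L : Finset ℕ+} {δ : ℕ+ → ℕ} {I : ℕ → Finset ℕ+}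

theorem countLE_union {𝓕 : Set (Finset ℕ+)} (h : IsScheme 𝓕 X L δ I) (e : ℕ) (n : ℕ+) :
    countLE (I e ∪ L.filter (δ · = e)) n = countLE (I e) n + countLE (L.filter (δ · = e)) n := by
  refine _root_.countLE_union (Finset.disjoint_right.2 fun m hm => ?_) n
  obtain ⟨hmL, rfl⟩ := Finset.mem_filter.1 hm
  exact h.notMem_node m hmL

/-- One step up the tree. The fibres of `u` are intervals replacing the nodes of depth `e + 1`; the
`i`-th starts no earlier than the `i`-th such node. Grouping these nodes into successive Schreier
sets therefore bundles the intervals into admissible sequences, no more numerous up to any point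
than the nodes of depth `e`. -/
theorem exists_blocks (hα : IsApproximatingSystem α) (hξ : ξ < ω₁) (hθ : 0 < θ) (hθ' : θ ≤ 1)
    (h : IsScheme (schreier α ξ) X L δ I) (e : ℕ) {G : Finset ℕ+} {w : ℕ+ → ℝ}
    (hw : ∀ n, 0 ≤ w n) {u : ℕ+ → ℕ} (hu : Monotone u)
    (hule : ∀ n, u n ≤ countLE (I (e + 1)) n + countLE (L.filter (δ · = e + 1)) n)
    (hupos : ∀ n ∈ G, 1 ≤ u n)
    (hdom : ∀ i, Dominated (schreier α ξ) θ w (G.filter (u · = i))) :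
    ∃ β : ℕ+ → ℕ, Monotone β ∧ (∀ n, β n ≤ countLE (I e) n) ∧ (∀ n ∈ G, 1 ≤ β n) ∧
      ∀ i, Dominated (schreier α ξ) θ (fun n => θ * w n) (G.filter (β · = i)) := by
  obtain ⟨A, hA, hP⟩ := h.children e
  set P := I (e + 1) ∪ L.filter (δ · = e + 1) with hPdef
  have huP (n) : u n ≤ countLE P n := (hule n).trans_eq (h.countLE_union (e + 1) n).symm
  obtain ⟨g, hg, hgle, hgfib⟩ := hasGrouping_schreier hα hξ (I e) id A (fun v => (hA v).1)
    (fun v => (hA v).2) P hP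
  obtain ⟨q, hq, hqlt, hqle⟩ := exists_enumeration P
  have hcard (n) : u n ≤ P.card := (huP n).trans (countLE_le_card _ _)
  have hqm {i j} (hi : 1 ≤ i) (hij : i ≤ j) (hj : j ≤ P.card) : q i ≤ q j := by
    rcases hij.eq_or_lt with rfl | hij
    exacts [le_rfl, (hqlt i j hi hij hj).le]
  -- The enumeration `q` is meaningful from 1 on; the value 0 marks points before the first
  -- interval.
  refine ⟨fun n => if u n = 0 then 0 else g (q (u n)), fun a b hab => ?_, fun n => ?_,
    fun n hn => ?_, fun i => ?_⟩
  · have := hu hab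
    dsimp only
    split_ifs with h1 h2 h2
    · exact le_rfl
    · exact Nat.zero_le _
    · omega
    · exact hg (hq _ (by omega) (hcard a)) (hq _ (by omega) (hcard b))
        (hqm (by omega) this (hcard b))
  · dsimp only
    split_ifs with h1
    · exact Nat.zero_le _
    · exact (hgle _ (hq _ (by omega) (hcard n))).2.trans
        (countLE_mono (I e) (hqle _ _ (by omega) (huP n)))
  · have h1 := hupos n hn
    dsimp only
    rw [if_neg (by omega)]
    exact (hgle _ (hq _ h1 (hcard n))).1
  · set H := G.filter (fun n => (if u n = 0 then 0 else g (q (u n))) = i) with hH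
    have hHmem : ∀ n ∈ H, n ∈ G ∧ g (q (u n)) = i := fun n hn => by
      obtain ⟨hn, hni⟩ := Finset.mem_filter.1 hn
      have := hupos n hn
      rw [if_neg (by omega)] at hni
      exact ⟨hn, hni⟩
    refine Dominated.combine hθ hθ' (u := u) (hu.monotoneOn _) ?_ fun j => ?_
    -- The first points of the intervals in a block are a spread of nodes in one fibre of `g`.
    · refine schreier_spread (hgfib i) (fun n => q (u n)) (fun a ha b hb hab => ?_)
        (fun n hn => ?_) fun n hn => ?_
      · obtain ⟨ha, -⟩ := Finset.mem_filter.1 ha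
        obtain ⟨hb, hb'⟩ := Finset.mem_filter.1 hb
        exact hqlt _ _ (hupos a (hHmem a ha).1) (lt_of_le_of_ne (hu hab.le) (hb' a ha hab))
          (hcard b)
      · obtain ⟨hnG, hni⟩ := hHmem n (Finset.mem_filter.1 hn).1
        exact Finset.mem_filter.2 ⟨hq _ (hupos n hnG) (hcard n), hni⟩
      · exact hqle _ _ (hupos n (hHmem n (Finset.mem_filter.1 hn).1).1) (huP n)
    · exact (hdom j).mono hw (Finset.filter_subset_filter _ (Finset.filter_subset _ _))

end IsScheme

/-- A monotone function with values at most `countLE Λ n - c` that separates the points of `S` from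
all other points. -/
theorem exists_separator {Λ S : Finset ℕ+} (hSΛ : S ⊆ Λ) (c : ℕ)
    (hS : ∀ n ∈ S, Even (countLE Λ n - c) ∧ 2 ≤ countLE Λ n - c) :
    ∃ κ : ℕ+ → ℕ, Monotone κ ∧ (∀ n, κ n ≤ countLE Λ n - c) ∧ (∀ n ∈ S, 1 ≤ κ n) ∧
      ∀ m n, m < n → m ∈ S ∨ n ∈ S → κ m < κ n := by
  -- Odd values are taken exactly on `S`: the function steps up at a point of `S` and again right
  -- after it, the two steps being paid for by that point and its predecessor in `Λ`.
  set κ : ℕ+ → ℕ := fun n => 2 * ((countLE Λ n - c) / 2) - if n ∈ S then 1 else 0 with hκ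
  have hκpos {n} (hn : n ∈ S) : κ n + 1 = countLE Λ n - c := by
    obtain ⟨⟨r, hr⟩, h2⟩ := hS n hn
    simp only [hκ, hn, if_true]
    omega
  have hκneg {n} (hn : n ∉ S) : κ n = 2 * ((countLE Λ n - c) / 2) := by
    simp [hκ, hn]
  have hκle (n) : κ n ≤ 2 * ((countLE Λ n - c) / 2) := Nat.sub_le _ _
  have hsep : ∀ m n, m < n → m ∈ S ∨ n ∈ S → κ m < κ n := fun m n hmn h => by
    have hm := hκle m
    have hle := countLE_mono Λ hmn.le
    by_cases hn : n ∈ S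
    · have hlt := countLE_lt (hSΛ hn) hmn
      have h1 := hκpos hn
      obtain ⟨⟨r, hr⟩, h2⟩ := hS n hn
      omega
    · have hmS := h.resolve_right hn
      have h1 := hκpos hmS
      obtain ⟨⟨r, hr⟩, h2⟩ := hS m hmS
      have h3 := hκneg hn
      omega
  refine ⟨κ, fun a b hab => ?_, fun n => ?_, fun n hn => ?_, hsep⟩
  · rcases hab.eq_or_lt with rfl | hlt
    · exact le_rfl
    by_cases h : a ∈ S ∨ b ∈ S
    · exact (hsep a b hlt h).le
    · push Not at h
      have := countLE_mono Λ hab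
      rw [hκneg h.1, hκneg h.2]
      omega
  · have := hκle n
    omega
  · have := hκpos hn
    have := (hS n hn).2
    omega

namespace IsScheme

variable {α : Ordinal.{0} → ℕ+ → Ordinal.{0}} {ξ : Ordinal.{0}} {θ : ℝ}
  {X L : Finset ℕ+} {δ : ℕ+ → ℕ} {I : ℕ → Finset ℕ+}

/-- Reduces domination to one combinatorial task per level: given the blocks `β` built from deeper
leaves, refine them within the budget of level `e` so that every leaf of `K` of depth `e` stands
alone. -/
theorem dominated_of_split (hα : IsApproximatingSystem α) (hξ : ξ < ω₁) (hθ : 0 < θ) (hθ' : θ ≤ 1)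
    (h : IsScheme (schreier α ξ) X L δ I) (K : Finset ℕ+)
    (hsplit : ∀ (e : ℕ) (β : ℕ+ → ℕ), Monotone β → (∀ n, β n ≤ countLE (I e) n) →
      (∀ n ∈ K, e < δ n → 1 ≤ β n) → ∃ u : ℕ+ → ℕ, Monotone u ∧
        (∀ n, u n ≤ countLE (I e) n + countLE (L.filter (δ · = e)) n) ∧
        (∀ n ∈ K, e ≤ δ n → 1 ≤ u n) ∧
        ∀ m ∈ K, ∀ n ∈ K, e ≤ δ m → e ≤ δ n → m < n → u m = u n →
          e < δ m ∧ e < δ n ∧ β m = β n) :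
    Dominated (schreier α ξ) θ (fun n => θ ^ δ n) K := by
  -- The induction runs over `d`, a bound for the number of levels from `e` downwards.
  have key : ∀ d e, (∀ n ∈ K, δ n < e + d) → ∃ u : ℕ+ → ℕ, Monotone u ∧
      (∀ n, u n ≤ countLE (I e) n + countLE (L.filter (δ · = e)) n) ∧
      (∀ n ∈ K.filter (e ≤ δ ·), 1 ≤ u n) ∧
      ∀ i, Dominated (schreier α ξ) θ (fun n => θ ^ (δ n - e))
        ((K.filter (e ≤ δ ·)).filter (u · = i)) := by
    intro d
    induction d with
    | zero =>
      intro e hd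
      have : K.filter (e ≤ δ ·) = ∅ := Finset.filter_false_of_mem fun n hn => by
        have := hd n hn
        omega
      refine ⟨fun _ => 0, monotone_const, by simp, by simp [this], fun i => ?_⟩
      rw [this]
      exact dominated_empty _
    | succ d ih =>
      intro e hd
      obtain ⟨v, hv, hvle, hvpos, hvdom⟩ := ih (e + 1) fun n hn => by
        have := hd n hn
        omega
      obtain ⟨β, hβ, hβle, hβpos, hβdom⟩ := h.exists_blocks hα hξ hθ hθ' e
        (fun n => by positivity) hv hvle hvpos hvdom
      obtain ⟨u, hu, hule, hupos, husep⟩ := hsplit e β hβ hβle fun n hn hlt =>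
        hβpos n (Finset.mem_filter.2 ⟨hn, hlt⟩)
      refine ⟨u, hu, hule, fun n hn => hupos n (Finset.mem_filter.1 hn).1
        (Finset.mem_filter.1 hn).2, fun i => ?_⟩
      set H := (K.filter (e ≤ δ ·)).filter (u · = i) with hH
      have hHmem : ∀ n ∈ H, n ∈ K ∧ e ≤ δ n ∧ u n = i := fun n hn => by
        obtain ⟨hn, hi⟩ := Finset.mem_filter.1 hn
        obtain ⟨hn, hle⟩ := Finset.mem_filter.1 hn
        exact ⟨hn, hle, hi⟩
      have hsep : ∀ m ∈ H, ∀ n ∈ H, m ≠ n → e < δ m ∧ β m = β n := fun m hm n hn hmn => by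
        obtain ⟨hm1, hm2, hm3⟩ := hHmem m hm
        obtain ⟨hn1, hn2, hn3⟩ := hHmem n hn
        rcases lt_or_gt_of_ne hmn with hlt | hlt
        · obtain ⟨h1, -, h3⟩ := husep m hm1 n hn1 hm2 hn2 hlt (hm3.trans hn3.symm)
          exact ⟨h1, h3⟩
        · obtain ⟨-, h2, h3⟩ := husep n hn1 m hm1 hn2 hm2 hlt (hn3.trans hm3.symm)
          exact ⟨h2, h3.symm⟩
      rcases H.eq_empty_or_nonempty with h0 | ⟨m, hm⟩
      · rw [h0]
        exact dominated_empty _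
      -- A fibre is either a single leaf of depth `e` or part of one block of deeper leaves.
      by_cases hme : δ m = e
      · have : H = {m} := Finset.eq_singleton_iff_unique_mem.2 ⟨hm, fun n hn => by
          by_contra hnm
          have := (hsep m hm n hn (Ne.symm hnm)).1
          omega⟩
        rw [this]
        exact dominated_singleton hθ' m (by simp [hme])
      · have hHe : ∀ n ∈ H, e < δ n := fun n hn => by
          by_cases hnm : n = m
          · have := (hHmem m hm).2.1
            rw [hnm]
            omega
          · exact (hsep n hn m hm hnm).1
        refine Dominated.mono (fun n => by positivity) (H := H) ?_ subset_rfl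
        refine Dominated.congr (((hβdom (β m)).mono (fun n => by positivity)
          (G := H) fun n hn => ?_)) fun n hn => ?_
        · refine Finset.mem_filter.2 ⟨Finset.mem_filter.2 ⟨(hHmem n hn).1, hHe n hn⟩, ?_⟩
          by_cases hnm : n = m
          · rw [hnm]
          · exact (hsep n hn m hm hnm).2
        · have := hHe n hn
          rw [← pow_succ']
          congr 1
          omega
  obtain ⟨D, hD⟩ : ∃ D, ∀ n ∈ K, δ n < 0 + D :=
    ⟨K.sup δ + 1, fun n hn => by
      have := Finset.le_sup (f := δ) hn
      omega⟩
  obtain ⟨u, -, hule, hupos, hdom⟩ := key D 0 hD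
  -- The budget at the root is one, so all of `K` lies in the fibre over 1.
  refine (hdom 1).mono (fun n => by positivity) fun n hn => ?_
  have hn' : n ∈ K.filter (0 ≤ δ ·) := Finset.mem_filter.2 ⟨hn, Nat.zero_le _⟩
  refine Finset.mem_filter.2 ⟨hn', le_antisymm ?_ (hupos n hn')⟩
  exact ((hule n).trans_eq (h.countLE_union 0 n).symm).trans ((countLE_le_card _ _).trans h.root)

/-- The rank of a leaf among the leaves of the same depth. -/
def rank (L : Finset ℕ+) (δ : ℕ+ → ℕ) (n : ℕ+) : ℕ := countLE (L.filter (δ · = δ n)) n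

theorem rank_pos {n : ℕ+} (hn : n ∈ L) : 1 ≤ rank L δ n :=
  countLE_pos (Finset.mem_filter.2 ⟨hn, rfl⟩) le_rfl

/-- Each leaf kept is preceded by a discarded leaf of the same depth, so two units are available to
isolate it: `β + κ` fits the budget. -/
theorem dominated_even (hα : IsApproximatingSystem α) (hξ : ξ < ω₁) (hθ : 0 < θ) (hθ' : θ ≤ 1)
    (h : IsScheme (schreier α ξ) X L δ I) :
    Dominated (schreier α ξ) θ (fun n => θ ^ δ n) (L.filter fun n => Even (rank L δ n)) := by
  refine h.dominated_of_split hα hξ hθ hθ' _ fun e β hβ hβle hβpos => ?_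
  set S := (L.filter fun n => Even (rank L δ n)).filter (δ · = e) with hS
  have hSmem {n} : n ∈ S ↔ (n ∈ L ∧ Even (rank L δ n)) ∧ δ n = e := by
    simp [hS]
  obtain ⟨κ, hκ, hκle, hκpos, hκsep⟩ := exists_separator (Λ := L.filter (δ · = e)) (S := S)
    (fun n hn => Finset.mem_filter.2 ⟨(hSmem.1 hn).1.1, (hSmem.1 hn).2⟩) 0 fun n hn => by
      obtain ⟨⟨hnL, heven⟩, rfl⟩ := hSmem.1 hn
      refine ⟨heven, ?_⟩
      have := rank_pos (δ := δ) hnL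
      obtain ⟨r, hr⟩ := heven
      change 2 ≤ rank L δ n - 0
      omega
  refine ⟨fun n => β n + κ n, hβ.add hκ, fun n => add_le_add (hβle n) (hκle n),
    fun n hn hen => ?_, fun m hm n hn hem hen hmn heq => ?_⟩
  · rcases hen.eq_or_lt with rfl | hlt
    · have := hκpos n (Finset.mem_filter.2 ⟨hn, rfl⟩)
      dsimp only
      omega
    · have := hβpos n hn hlt
      dsimp only
      omega
  · dsimp only at heq
    have h1 := hβ hmn.le
    have h2 := hκ hmn.le
    have hS' : ¬ (m ∈ S ∨ n ∈ S) := fun hor => by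
      have := hκsep m n hmn hor
      omega
    push Not at hS'
    refine ⟨lt_of_le_of_ne hem fun h => hS'.1 (Finset.mem_filter.2 ⟨hm, h.symm⟩),
      lt_of_le_of_ne hen fun h => hS'.2 (Finset.mem_filter.2 ⟨hn, h.symm⟩), by omega⟩

/-- The same pairing, shifted by one (`c = 1`), serves odd ranks from 3 on and leaves the unit of
the rank-one leaf free. That unit suffices to isolate the leaf 2, which has no point of `X` to its
left. -/
theorem dominated_odd (hα : IsApproximatingSystem α) (hξ : ξ < ω₁) (hθ : 0 < θ) (hθ' : θ ≤ 1)
    (h : IsScheme (schreier α ξ) X L δ I) (hX : ∀ n ∈ X, 2 ≤ n) :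
    Dominated (schreier α ξ) θ (fun n => θ ^ δ n)
      (L.filter fun n => ¬ Even (rank L δ n) ∧ (3 ≤ rank L δ n ∨ n = 2)) := by
  refine h.dominated_of_split hα hξ hθ hθ' _ fun e β hβ hβle hβpos => ?_
  set K := L.filter fun n => ¬ Even (rank L δ n) ∧ (3 ≤ rank L δ n ∨ n = 2) with hK
  set S := L.filter (fun n => (¬ Even (rank L δ n) ∧ 3 ≤ rank L δ n) ∧ δ n = e) with hS
  have hSmem {n} : n ∈ S ↔ n ∈ L ∧ (¬ Even (rank L δ n) ∧ 3 ≤ rank L δ n) ∧ δ n = e := by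
    simp [hS]
  have hKmem {n} (hn : n ∈ K) : n ∈ L ∧ ¬ Even (rank L δ n) ∧ (3 ≤ rank L δ n ∨ n = 2) := by
    simpa [hK] using hn
  obtain ⟨κ, hκ, hκle, hκpos, hκsep⟩ := exists_separator (Λ := L.filter (δ · = e)) (S := S)
    (fun n hn => Finset.mem_filter.2 ⟨(hSmem.1 hn).1, (hSmem.1 hn).2.2⟩) 1 fun n hn => by
      obtain ⟨hnL, ⟨hodd, h3⟩, rfl⟩ := hSmem.1 hn
      change Even (rank L δ n - 1) ∧ 2 ≤ rank L δ n - 1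
      obtain ⟨r, hr⟩ := Nat.not_even_iff_odd.1 hodd
      exact ⟨⟨r, by omega⟩, by omega⟩
  have hKS {n} (hn : n ∈ K) (hne : δ n = e) (hn2 : n ≠ 2) : n ∈ S := by
    obtain ⟨hnL, hodd, hor⟩ := hKmem hn
    exact hSmem.2 ⟨hnL, ⟨hodd, hor.resolve_right hn2⟩, hne⟩
  have hpos {n} (hn : n ∈ K) (hen : e ≤ δ n) (hn2 : δ n = e → n ≠ 2) : 1 ≤ β n + κ n := by
    rcases hen.eq_or_lt with heq | hlt
    · have := hκpos n (hKS hn heq.symm (hn2 heq.symm))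
      omega
    · have := hβpos n hn hlt
      omega
  have hsep {m n} (hm : m ∈ K) (hn : n ∈ K) (hem : e ≤ δ m) (hen : e ≤ δ n) (hmn : m < n)
      (hm2 : δ m = e → m ≠ 2) (hn2 : δ n = e → n ≠ 2) (heq : β m + κ m = β n + κ n) :
      e < δ m ∧ e < δ n ∧ β m = β n := by
    have h1 := hβ hmn.le
    have h2 := hκ hmn.le
    have hS' : ¬ (m ∈ S ∨ n ∈ S) := fun hor => by
      have := hκsep m n hmn hor
      omega
    push Not at hS'
    refine ⟨lt_of_le_of_ne hem fun h => hS'.1 (hKS hm h.symm (hm2 h.symm)),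
      lt_of_le_of_ne hen fun h => hS'.2 (hKS hn h.symm (hn2 h.symm)), by omega⟩
  by_cases h2 : 2 ∈ L ∧ δ 2 = e
  · have ht {n : ℕ+} (hn : 2 ≤ n) : 1 ≤ countLE (L.filter (δ · = e)) n :=
      countLE_pos (Finset.mem_filter.2 h2) hn
    have hge {n : ℕ+} (hn : n ∈ K) (hn2 : n ≠ 2) : ¬ n ≤ 2 := fun hle =>
      hn2 (le_antisymm hle (hX n (h.leaf_subset (hKmem hn).1)))
    -- The leaf 2 gets the label 1 and all later labels rise by one; the shift in `κ` makes room for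
    -- this.
    refine ⟨fun n => if n ≤ 2 then (if n = 2 then 1 else 0) else β n + κ n + 1,
      fun a b hab => ?_, fun n => ?_, fun n hn hen => ?_, fun m hm n hn hem hen hmn heq => ?_⟩
    · have h3 := hβ hab
      have h4 := hκ hab
      dsimp only
      by_cases hb : b ≤ 2
      · rw [if_pos hb, if_pos (hab.trans hb)]
        by_cases ha2 : a = 2
        · rw [if_pos ha2, if_pos (le_antisymm hb (ha2 ▸ hab))]
        · rw [if_neg ha2]
          exact Nat.zero_le _
      · rw [if_neg hb]
        split_ifs <;> omega
    · dsimp only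
      split_ifs with h3 h4
      · have := ht h4.ge
        omega
      · exact Nat.zero_le _
      · have h5 := ht (not_le.1 h3).le
        have h6 := hκle n
        have h7 := hβle n
        omega
    · dsimp only
      by_cases hn2 : n = 2
      · simp [hn2]
      · rw [if_neg (hge hn hn2)]
        omega
    · dsimp only at heq
      have hm2 : 2 ≤ m := hX m (h.leaf_subset (hKmem hm).1)
      have hn2 : n ≠ 2 := (hm2.trans_lt hmn).ne'
      rw [if_neg (hge hn hn2)] at heq
      have := hpos hn hen fun _ => hn2
      by_cases hm2 : m = 2
      · rw [if_pos hm2.le, if_pos hm2] at heq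
        omega
      · rw [if_neg (hge hm hm2)] at heq
        exact hsep hm hn hem hen hmn (fun _ => hm2) (fun _ => hn2) (by omega)
  · have hne {n} (hn : n ∈ K) (hne : δ n = e) : n ≠ 2 := by
      rintro rfl
      exact h2 ⟨(hKmem hn).1, hne⟩
    exact ⟨fun n => β n + κ n, hβ.add hκ,
      fun n => add_le_add (hβle n) ((hκle n).trans (Nat.sub_le _ _)),
      fun n hn hen => hpos hn hen (hne hn),
      fun m hm n hn hem hen hmn heq => hsep hm hn hem hen hmn (hne hm) (hne hn) heq⟩

end IsScheme

/-! ### Leaves of pairwise different depths, and the bound for schemes. -/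

section Caterpillar

variable {α : Ordinal.{0} → ℕ+ → Ordinal.{0}} {ξ : Ordinal.{0}} {θ : ℝ}

/-- A set with at most one leaf at each depth. -/
theorem dominated_of_injOn (hα : IsApproximatingSystem α) (hξ : ξ < ω₁) (hξ0 : ξ ≠ 0)
    (hθ : 0 < θ) (hθ' : θ ≤ 1) {δ : ℕ+ → ℕ} {K : Finset ℕ+} (hK : ∀ n ∈ K, 3 ≤ n)
    (hδ : Set.InjOn δ K) (hδ0 : ∀ n ∈ K, 0 < δ n) :
    Dominated (schreier α ξ) θ (fun n => θ ^ δ n) K := by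
  have key : ∀ d e, (∀ n ∈ K, δ n < e + d) →
      Dominated (schreier α ξ) θ (fun n => θ ^ (δ n - e)) (K.filter (e < δ ·)) := by
    intro d
    induction d with
    | zero =>
      intro e hd
      rw [Finset.filter_false_of_mem fun n hn => by have := hd n hn; omega]
      exact dominated_empty _
    | succ d ih =>
      intro e hd
      have hrec := ih (e + 1) fun n hn => by have := hd n hn; omega
      set G := K.filter (e < δ ·) with hG
      have hGmem : ∀ n ∈ G, n ∈ K ∧ e < δ n := fun n hn => Finset.mem_filter.1 hn
      obtain ⟨ℓ, hℓ⟩ : ∃ ℓ : ℕ+, ∀ n ∈ G, δ n = e + 1 → n = ℓ := by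
        by_cases h : ∃ ℓ ∈ G, δ ℓ = e + 1
        · obtain ⟨ℓ, hℓ, hℓe⟩ := h
          exact ⟨ℓ, fun n hn hne => hδ (hGmem n hn).1 (hGmem ℓ hℓ).1 (hne.trans hℓe.symm)⟩
        · push Not at h
          exact ⟨1, fun n hn hne => absurd hne (h n hn)⟩
      -- The values 0, 1, 2 mean before, at and after the leaf `ℓ` of depth `e + 1`. The three
      -- minima are at least 3, hence the fibres are admissible.
      set u : ℕ+ → ℕ := fun n => (if ℓ ≤ n then 1 else 0) + (if ℓ < n then 1 else 0) with hu
      have humono : Monotone u := fun a b hab => by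
        simp only [hu]
        refine add_le_add ?_ ?_
        · by_cases h : ℓ ≤ a
          · rw [if_pos h, if_pos (h.trans hab)]
          · rw [if_neg h]; exact Nat.zero_le _
        · by_cases h : ℓ < a
          · rw [if_pos h, if_pos (h.trans_le hab)]
          · rw [if_neg h]; exact Nat.zero_le _
      have hule (n) : u n < 3 := by
        simp only [hu]
        split_ifs <;> omega
      have huℓ (n) : u n = 1 ↔ n = ℓ := by
        simp only [hu]
        rcases lt_trichotomy n ℓ with h | h | h
        · simp [h.not_ge, h.not_gt, h.ne]
        · simp [h]
        · simp [h, h.le, h.ne']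
      refine (Dominated.combine hθ hθ' (u := u) (w := fun n => θ ^ (δ n - (e + 1)))
        (humono.monotoneOn _) ?_ fun i => ?_).congr fun n hn => ?_
      · refine mem_schreier_of_card_le hα hξ hξ0 3 ?_ fun m hm =>
          hK m (hGmem m (Finset.mem_filter.1 hm).1).1
        have : ((3 : ℕ+) : ℕ) = (Finset.range 3).card := by simp
        rw [this]
        refine Finset.card_le_card_of_injOn u (fun n _ => by simpa using hule n)
          fun a ha b hb hab => ?_
        obtain ⟨ha, ha'⟩ := Finset.mem_filter.1 ha
        obtain ⟨hb, hb'⟩ := Finset.mem_filter.1 hb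
        rcases lt_trichotomy a b with h | h | h
        · exact absurd hab (hb' a ha h)
        · exact h
        · exact absurd hab.symm (ha' b hb h)
      · by_cases hc : ∃ n ∈ G.filter (u · = i), δ n = e + 1
        · obtain ⟨n, hn, hne⟩ := hc
          obtain ⟨hnG, rfl⟩ := Finset.mem_filter.1 hn
          have hn1 := (huℓ n).2 (hℓ n hnG hne)
          refine Dominated.mono (fun n => by positivity)
            (dominated_singleton hθ' n (by simp [hne])) fun m hm => ?_
          obtain ⟨hm, hmu⟩ := Finset.mem_filter.1 hm
          rw [Finset.mem_singleton, hℓ n hnG hne]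
          exact (huℓ m).1 (hmu.trans hn1)
        · push Not at hc
          refine hrec.mono (fun n => by positivity) fun n hn => ?_
          have h1 := hc n hn
          obtain ⟨h2, h3⟩ := hGmem n (Finset.mem_filter.1 hn).1
          exact Finset.mem_filter.2 ⟨h2, by omega⟩
      · have := (hGmem n hn).2
        rw [← pow_succ']
        congr 1
        omega
  have := key (K.sup δ + 1) 0 fun n hn => by
    have := Finset.le_sup (f := δ) hn
    omega
  rwa [Finset.filter_true_of_mem hδ0] at this

end Caterpillar

/-- A functional given by a scheme is bounded by three times the Tsirelson norm. -/
theorem IsScheme.sum_le {α : Ordinal.{0} → ℕ+ → Ordinal.{0}} {ξ : Ordinal.{0}} {θ : ℝ}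
    {X L : Finset ℕ+} {δ : ℕ+ → ℕ} {I : ℕ → Finset ℕ+}
    (hα : IsApproximatingSystem α) (hξ : ξ < ω₁) (hξ0 : ξ ≠ 0) (hθ : 0 < θ) (hθ' : θ ≤ 1)
    (h : IsScheme (schreier α ξ) X L δ I) (hX : ∀ n ∈ X, 2 ≤ n) (hδ : ∀ n ∈ L, 0 < δ n)
    (x : ℕ+ →₀ ℝ) :
    ∑ n ∈ L, θ ^ δ n * |x n| ≤ 3 * tsirelsonNorm (schreier α ξ) θ x := by
  have h1 := h.dominated_even hα hξ hθ hθ' x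
  have h2 := h.dominated_odd hα hξ hθ hθ' hX x
  -- What remains has rank one, hence one leaf per depth, and avoids 2, so that it starts at 3.
  set K := L.filter fun n => ¬ Even (rank L δ n) ∧ ¬ (3 ≤ rank L δ n ∨ n = 2) with hK
  have hKmem : ∀ n ∈ K, n ∈ L ∧ rank L δ n = 1 ∧ n ≠ 2 := fun n hn => by
    obtain ⟨hnL, hodd, hnot⟩ := Finset.mem_filter.1 hn
    push Not at hnot
    obtain ⟨r, hr⟩ := Nat.not_even_iff_odd.1 hodd
    exact ⟨hnL, by omega, hnot.2⟩
  have h3 : ∑ n ∈ K, θ ^ δ n * |x n| ≤ tsirelsonNorm (schreier α ξ) θ x := by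
    refine dominated_of_injOn hα hξ hξ0 hθ hθ' (fun n hn => ?_) (fun a ha b hb hab => ?_)
      (fun n hn => hδ n (hKmem n hn).1) x
    · obtain ⟨hnL, -, hn2⟩ := hKmem n hn
      exact Order.succ_le_of_lt (lt_of_le_of_ne (hX n (h.leaf_subset hnL)) hn2.symm)
    · obtain ⟨haL, ha1, -⟩ := hKmem a ha
      obtain ⟨hbL, hb1, -⟩ := hKmem b hb
      have hlt : ∀ a ∈ L, ∀ b ∈ L, δ a = δ b → a < b → rank L δ a < rank L δ b := by
        intro a _ b hb hab hlt
        unfold rank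
        rw [hab]
        exact countLE_lt (Finset.mem_filter.2 ⟨hb, rfl⟩) hlt
      rcases lt_trichotomy a b with hlt' | heq | hlt'
      · have := hlt a haL b hbL hab hlt'
        omega
      · exact heq
      · have := hlt b hbL a haL hab.symm hlt'
        omega
  have hsum := Finset.sum_filter_add_sum_filter_not L (fun n => Even (rank L δ n))
    fun n => θ ^ δ n * |x n|
  have hsum' := Finset.sum_filter_add_sum_filter_not (L.filter fun n => ¬ Even (rank L δ n))
    (fun n => 3 ≤ rank L δ n ∨ n = 2) fun n => θ ^ δ n * |x n|
  rw [Finset.filter_filter, Finset.filter_filter] at hsum'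
  linarith

/-! ### Schemes that nearly attain the norm. -/

theorem exists_glue {ι β : Type*} (X : ι → Finset ℕ+) (hX : ∀ i j, i ≠ j → Disjoint (X i) (X j))
    (f : ι → ℕ+ → β) (b : β) :
    ∃ F : ℕ+ → β, (∀ i, ∀ n ∈ X i, F n = f i n) ∧ ∀ n, (∀ i, n ∉ X i) → F n = b := by
  classical
  refine ⟨fun n => if h : ∃ i, n ∈ X i then f h.choose n else b, fun i n hn => ?_, fun n hn => ?_⟩
  · have h : ∃ i, n ∈ X i := ⟨i, hn⟩
    have : h.choose = i := by
      by_contra hne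
      exact Finset.disjoint_left.1 (hX _ _ hne) h.choose_spec hn
    dsimp only
    rw [dif_pos h, this]
  · dsimp only
    rw [dif_neg]
    rintro ⟨i, hi⟩
    exact hn i hi

namespace IsScheme

variable {α : Ordinal.{0} → ℕ+ → Ordinal.{0}} {ξ : Ordinal.{0}} {θ : ℝ}

theorem empty {𝓕 : Set (Finset ℕ+)} (h𝓕 : ∅ ∈ 𝓕) (X : Finset ℕ+) :
    IsScheme 𝓕 X ∅ (fun _ => 0) (fun _ => ∅) where
  leaf_subset := Finset.empty_subset _
  node_subset _ := Finset.empty_subset _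
  notMem_node := by simp
  root := by simp
  children e := ⟨fun _ => ∅, fun _ => ⟨h𝓕, by simp⟩, by simp⟩

theorem singleton {𝓕 : Set (Finset ℕ+)} (h𝓕 : ∅ ∈ 𝓕) {X : Finset ℕ+} {n : ℕ+} (hn : n ∈ X) :
    IsScheme 𝓕 X {n} (fun _ => 0) (fun _ => ∅) where
  leaf_subset := by simpa using hn
  node_subset _ := Finset.empty_subset _
  notMem_node := by simp
  root := by simp
  children e := ⟨fun _ => ∅, fun _ => ⟨h𝓕, by simp⟩, by simp⟩

/-- The trees are hung below a new root. Only disjointness of the `X i` is needed, so this serves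
both the admissible families inside the norm and the final allowable family. -/
theorem combine (hα : IsApproximatingSystem α) (hξ : ξ < ω₁) {k : ℕ} {X L : Fin k → Finset ℕ+}
    {δ : Fin k → ℕ+ → ℕ} {I : Fin k → ℕ → Finset ℕ+}
    (h : ∀ i, IsScheme (schreier α ξ) (X i) (L i) (δ i) (I i))
    (hX : ∀ i j, i ≠ j → Disjoint (X i) (X j)) {m : Fin k → ℕ+} (hm : Function.Injective m)
    (hmem : Finset.univ.image m ∈ schreier α ξ) (hle : ∀ i, ∀ n ∈ X i, m i ≤ n)
    {Y : Finset ℕ+} (hXY : ∀ i, X i ⊆ Y) :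
    ∃ (L' : Finset ℕ+) (δ' : ℕ+ → ℕ) (I' : ℕ → Finset ℕ+),
      IsScheme (schreier α ξ) Y L' δ' I' ∧ (∀ n ∈ L', 0 < δ' n) ∧
      ∀ f : ℕ+ → ℝ, ∑ n ∈ L', θ ^ δ' n * f n = θ * ∑ i, ∑ n ∈ L i, θ ^ δ i n * f n := by
  have he := empty_mem_schreier hα hξ
  obtain ⟨δ', hδ', -⟩ := exists_glue X hX (fun i n => δ i n + 1) 0
  set A := Finset.univ.biUnion fun i => I i 0 ∪ (L i).filter (δ i · = 0) with hAdef
  have hrootX (i) : I i 0 ∪ (L i).filter (δ i · = 0) ⊆ X i :=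
    Finset.union_subset ((h i).node_subset 0)
      ((Finset.filter_subset _ _).trans (h i).leaf_subset)
  -- Each tree has at most one root point, at or after `m i`, so `A` is a spread of a subset of the
  -- `m i`.
  have hA : A ∈ schreier α ξ := by
    refine schreier_spread_of_countLE hmem fun n => ?_
    have hex : ∀ p ∈ A, ∃ q, ∃ i, p ∈ I i 0 ∪ (L i).filter (δ i · = 0) ∧ q = m i := fun p hp => by
      obtain ⟨i, -, hi⟩ := Finset.mem_biUnion.1 hp
      exact ⟨m i, i, hi, rfl⟩
    choose! c hc using hex
    refine Finset.card_le_card_of_injOn c (fun p hp => ?_) fun p hp q hq hpq => ?_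
    · obtain ⟨hp, hpn⟩ := Finset.mem_filter.1 hp
      obtain ⟨i, hi, hci⟩ := hc p hp
      refine Finset.mem_filter.2 ⟨Finset.mem_image.2 ⟨i, Finset.mem_univ _, hci.symm⟩, ?_⟩
      rw [hci]
      exact (hle i p (hrootX i hi)).trans hpn
    · obtain ⟨i, hi, hci⟩ := hc p (Finset.mem_filter.1 hp).1
      obtain ⟨j, hj, hcj⟩ := hc q (Finset.mem_filter.1 hq).1
      obtain rfl : i = j := hm (by rw [← hci, ← hcj, hpq])
      exact Finset.card_le_one.1 (h i).root p hi q hj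
  have hAY : A ⊆ Y := Finset.biUnion_subset.2 fun i _ => (hrootX i).trans (hXY i)
  obtain ⟨R, hRY, hRcard, hR⟩ : ∃ R ⊆ Y, R.card ≤ 1 ∧ ∀ p ∈ A, ∃ v ∈ R, ∀ n ∈ A, v ≤ n := by
    rcases A.eq_empty_or_nonempty with h0 | h0
    · exact ⟨∅, Finset.empty_subset _, by simp, by simp [h0]⟩
    · exact ⟨{A.min' h0}, Finset.singleton_subset_iff.2 (hAY (Finset.min'_mem _ _)), by simp,
        fun p _ => ⟨_, Finset.mem_singleton_self _, fun n hn => Finset.min'_le _ _ hn⟩⟩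
  set L' := Finset.univ.biUnion L with hL'
  have hL'mem {n} (hn : n ∈ L') : ∃ i, n ∈ L i ∧ δ' n = δ i n + 1 := by
    obtain ⟨i, -, hi⟩ := Finset.mem_biUnion.1 hn
    exact ⟨i, hi, hδ' i n ((h i).leaf_subset hi)⟩
  set I' : ℕ → Finset ℕ+ := fun e => Nat.casesOn e R fun e => Finset.univ.biUnion fun i => I i e
    with hI'
  have hI'mem {e n} (hn : n ∈ I' (e + 1)) : ∃ i, n ∈ I i e := by
    obtain ⟨i, -, hi⟩ := Finset.mem_biUnion.1 hn
    exact ⟨i, hi⟩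
  have hlevel {e p} (hp : p ∈ I' (e + 1) ∪ L'.filter (δ' · = e + 1)) :
      ∃ i, p ∈ I i e ∪ (L i).filter (δ i · = e) := by
    rcases Finset.mem_union.1 hp with hp | hp
    · obtain ⟨i, hi⟩ := hI'mem hp
      exact ⟨i, Finset.mem_union_left _ hi⟩
    · obtain ⟨hp, hpe⟩ := Finset.mem_filter.1 hp
      obtain ⟨i, hi, hδi⟩ := hL'mem hp
      exact ⟨i, Finset.mem_union_right _ (Finset.mem_filter.2 ⟨hi, by omega⟩)⟩
  refine ⟨L', δ', I', ⟨Finset.biUnion_subset.2 fun i _ => (h i).leaf_subset.trans (hXY i),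
    fun e => ?_, fun n hn => ?_, ?_, fun e => ?_⟩, fun n hn => ?_, fun f => ?_⟩
  · cases e with
    | zero => exact hRY
    | succ e => exact Finset.biUnion_subset.2 fun i _ => ((h i).node_subset e).trans (hXY i)
  · obtain ⟨i, hi, hδi⟩ := hL'mem hn
    rw [hδi]
    intro hmem
    obtain ⟨j, hj⟩ := hI'mem hmem
    by_cases hij : i = j
    · subst hij
      exact (h i).notMem_node n hi hj
    · exact Finset.disjoint_left.1 (hX i j hij) ((h i).leaf_subset hi) ((h j).node_subset _ hj)
  · have : L'.filter (δ' · = 0) = ∅ := Finset.filter_false_of_mem fun n hn => by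
      obtain ⟨i, hi, hδi⟩ := hL'mem hn
      omega
    rw [this, Finset.union_empty]
    exact hRcard
  · cases e with
    | zero =>
      -- The set is all of `A` if `v` bounds it from below and empty otherwise, since `v ≤ A v` is
      -- demanded of every `v`.
      refine ⟨fun v => A.filter fun _ => ∀ n ∈ A, v ≤ n, fun v =>
        ⟨schreier_subset hA (Finset.filter_subset _ _), fun n hn => ?_⟩, fun p hp => ?_⟩
      · obtain ⟨hn, hv⟩ := Finset.mem_filter.1 hn
        exact hv n hn
      · obtain ⟨i, hi⟩ := hlevel hp
        have hpA : p ∈ A := Finset.mem_biUnion.2 ⟨i, Finset.mem_univ _, hi⟩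
        obtain ⟨v, hvR, hv⟩ := hR p hpA
        exact ⟨v, hvR, Finset.mem_filter.2 ⟨hpA, hv⟩⟩
    | succ e =>
      choose B hB hBmem using fun i => (h i).children e
      obtain ⟨B', hB', hB'0⟩ := exists_glue X hX B ∅
      refine ⟨B', fun v => ?_, fun p hp => ?_⟩
      · by_cases hv : ∃ i, v ∈ X i
        · obtain ⟨i, hi⟩ := hv
          rw [hB' i v hi]
          exact hB i v
        · push Not at hv
          rw [hB'0 v hv]
          exact ⟨he, by simp⟩
      · obtain ⟨i, hi⟩ := hlevel hp
        obtain ⟨v, hv, hpv⟩ := hBmem i p hi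
        refine ⟨v, Finset.mem_biUnion.2 ⟨i, Finset.mem_univ _, hv⟩, ?_⟩
        rwa [hB' i v ((h i).node_subset e hv)]
  · obtain ⟨i, hi, hδi⟩ := hL'mem hn
    omega
  · rw [hL', Finset.sum_biUnion fun i _ j _ hij => (hX i j hij).mono (h i).leaf_subset
      (h j).leaf_subset, Finset.mul_sum]
    refine Finset.sum_congr rfl fun i _ => ?_
    rw [Finset.mul_sum]
    refine Finset.sum_congr rfl fun n hn => ?_
    rw [hδ' i n ((h i).leaf_subset hn), pow_succ']
    ring

theorem exists_of_lt_iSup {𝓕 : Set (Finset ℕ+)} (h𝓕 : ∅ ∈ 𝓕) {x : ℕ+ →₀ ℝ} {X : Finset ℕ+}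
    (hx : x.support ⊆ X) {r : ℝ} (hr : ENNReal.ofReal r < ⨆ n, ‖x n‖ₑ) :
    ∃ (L : Finset ℕ+) (δ : ℕ+ → ℕ) (I : ℕ → Finset ℕ+), IsScheme 𝓕 X L δ I ∧
      r ≤ ∑ n ∈ L, θ ^ δ n * |x n| := by
  obtain ⟨n, hn⟩ := lt_iSup_iff.1 hr
  have hxn : x n ≠ 0 := fun h0 => by simp [h0] at hn
  refine ⟨{n}, _, _, singleton h𝓕 (hx (Finsupp.mem_support_iff.2 hxn)), ?_⟩
  rw [← ofReal_norm, ENNReal.ofReal_lt_ofReal_iff (norm_pos_iff.2 hxn)] at hn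
  simpa using hn.le

/-- Unfolding one iterate adds one level to the tree; the slack `ε` absorbs suprema that need not be
attained. -/
theorem exists_tsirelsonIter_le (hα : IsApproximatingSystem α) (hξ : ξ < ω₁) (hθ : 0 < θ)
    (hθ' : θ ≤ 1) (s : ℕ) (x : ℕ+ →₀ ℝ) (X : Finset ℕ+) (hx : x.support ⊆ X) (ε : ℝ) (hε : 0 < ε) :
    ∃ (L : Finset ℕ+) (δ : ℕ+ → ℕ) (I : ℕ → Finset ℕ+), IsScheme (schreier α ξ) X L δ I ∧
      (tsirelsonIter (schreier α ξ) θ s x).toReal ≤ ∑ n ∈ L, θ ^ δ n * |x n| + ε := by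
  have he := empty_mem_schreier hα hξ
  have htop : ∀ s x, tsirelsonIter (schreier α ξ) θ s x ≠ ∞ := fun s x =>
    ne_top_of_le_ne_top (iSup_tsirelsonIter_ne_top hθ' x)
      (le_iSup (fun s => tsirelsonIter (schreier α ξ) θ s x) s)
  induction s generalizing x X ε with
  | zero =>
    set t := (tsirelsonIter (schreier α ξ) θ 0 x).toReal with ht
    by_cases htε : t ≤ ε
    · exact ⟨∅, _, _, empty he X, by simpa using htε⟩
    have hlt : ENNReal.ofReal (t - ε) < tsirelsonIter (schreier α ξ) θ 0 x :=
      (ENNReal.ofReal_lt_iff_lt_toReal (by linarith) (htop 0 x)).2 (by linarith)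
    obtain ⟨L, δ, I, h, hle⟩ := exists_of_lt_iSup (θ := θ) he hx hlt
    exact ⟨L, δ, I, h, by linarith⟩
  | succ s ih =>
    set t := (tsirelsonIter (schreier α ξ) θ (s + 1) x).toReal with ht
    by_cases htε : t ≤ ε / 2
    · exact ⟨∅, _, _, empty he X, by simp; linarith⟩
    have hlt : ENNReal.ofReal (t - ε / 2) < tsirelsonIter (schreier α ξ) θ (s + 1) x :=
      (ENNReal.ofReal_lt_iff_lt_toReal (by linarith) (htop (s + 1) x)).2 (by linarith)
    rcases lt_max_iff.1 hlt with hlt | hlt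
    · obtain ⟨L, δ, I, h, hle⟩ := exists_of_lt_iSup (θ := θ) he hx hlt
      exact ⟨L, δ, I, h, by linarith⟩
    simp only [ENNReal.mul_iSup, lt_iSup_iff] at hlt
    obtain ⟨k, E, hE, hlt⟩ := hlt
    have hlt' : t - ε / 2 < θ * ∑ i, (tsirelsonIter (schreier α ξ) θ s (proj (E i) x)).toReal := by
      have hne : ENNReal.ofReal θ * ∑ i, tsirelsonIter (schreier α ξ) θ s (proj (E i) x) ≠ ∞ :=
        ENNReal.mul_ne_top ENNReal.ofReal_ne_top (ENNReal.sum_ne_top.2 fun i _ => htop _ _)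
      have := (ENNReal.ofReal_lt_iff_lt_toReal (by linarith) hne).1 hlt
      rwa [ENNReal.toReal_mul, ENNReal.toReal_ofReal hθ.le,
        ENNReal.toReal_sum fun i _ => htop _ _] at this
    have hsupp (i) : (proj (E i) x).support ⊆ X ∩ E i := fun n hn => by
      have hn' := Finsupp.support_filter (p := (· ∈ E i)) (f := x) ▸ hn
      exact Finset.mem_inter.2 ⟨hx (Finset.mem_filter.1 hn').1, (Finset.mem_filter.1 hn').2⟩
    -- The `k` errors add up to at most `ε / 2`; the denominator `k + 1` also covers `k = 0`.
    have hη : 0 < ε / 2 / (k + 1) := by positivity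
    choose L δ I h hle using fun i => ih (proj (E i) x) (X ∩ E i) (hsupp i) _ hη
    obtain ⟨m, hm, hmem⟩ := hE.2
    obtain ⟨L', δ', I', h', -, hval⟩ := combine (θ := θ) hα hξ h
      (fun i j hij => Finset.disjoint_left.2 fun n hi hj =>
        hE.disjoint hij (Finset.mem_inter.1 hi).2 (Finset.mem_inter.1 hj).2)
      (m := m) (fun i j hij => by
        by_contra hne
        exact hE.disjoint hne (Finset.mem_coe.1 (hm i).1) (hij ▸ Finset.mem_coe.1 (hm j).1)) hmem
      (fun i n hn => (hm i).2 (Finset.mem_coe.2 (Finset.mem_inter.1 hn).2))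
      (Y := X) fun i => Finset.inter_subset_left
    refine ⟨L', δ', I', h', ?_⟩
    rw [hval]
    have hsum : ∑ i, (tsirelsonIter (schreier α ξ) θ s (proj (E i) x)).toReal ≤
        ∑ i, ∑ n ∈ L i, θ ^ δ i n * |x n| + ε / 2 := by
      calc ∑ i, (tsirelsonIter (schreier α ξ) θ s (proj (E i) x)).toReal
          ≤ ∑ i, (∑ n ∈ L i, θ ^ δ i n * |x n| + ε / 2 / (k + 1)) := by
            refine Finset.sum_le_sum fun i _ => (hle i).trans (le_of_eq ?_)
            congr 1
            refine Finset.sum_congr rfl fun n hn => ?_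
            have : proj (E i) x n = x n := Finsupp.filter_apply_pos (· ∈ E i) x
              (Finset.mem_inter.1 ((h i).leaf_subset hn)).2
            rw [this]
        _ = ∑ i, ∑ n ∈ L i, θ ^ δ i n * |x n| + k * (ε / 2 / (k + 1)) := by
            simp [Finset.sum_add_distrib]
        _ ≤ _ := by
            have : (k : ℝ) * (ε / 2 / (k + 1)) ≤ ε / 2 := by
              rw [← mul_div_assoc, div_le_iff₀ (by positivity)]
              nlinarith
            linarith
    have := mul_le_mul_of_nonneg_left hsum hθ.le
    nlinarith

theorem exists_tsirelsonNorm_le (hα : IsApproximatingSystem α) (hξ : ξ < ω₁) (hθ : 0 < θ)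
    (hθ' : θ ≤ 1) (x : ℕ+ →₀ ℝ) (X : Finset ℕ+) (hx : x.support ⊆ X) (ε : ℝ) (hε : 0 < ε) :
    ∃ (L : Finset ℕ+) (δ : ℕ+ → ℕ) (I : ℕ → Finset ℕ+), IsScheme (schreier α ξ) X L δ I ∧
      tsirelsonNorm (schreier α ξ) θ x ≤ ∑ n ∈ L, θ ^ δ n * |x n| + ε := by
  set t := tsirelsonNorm (schreier α ξ) θ x with ht
  by_cases htε : t ≤ ε / 2
  · exact ⟨∅, _, _, empty (empty_mem_schreier hα hξ) X, by simp; linarith⟩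
  have htop := iSup_tsirelsonIter_ne_top (𝓕 := schreier α ξ) hθ' x
  have hlt : ENNReal.ofReal (t - ε / 2) < ⨆ s, tsirelsonIter (schreier α ξ) θ s x :=
    (ENNReal.ofReal_lt_iff_lt_toReal (by linarith) htop).2 (by
      change t - ε / 2 < t
      linarith)
  obtain ⟨s, hs⟩ := lt_iSup_iff.1 hlt
  have hs' := (ENNReal.ofReal_lt_iff_lt_toReal (by linarith) (ne_top_of_le_ne_top htop
    (le_iSup (fun s => tsirelsonIter (schreier α ξ) θ s x) s))).1 hs
  obtain ⟨L, δ, I, h, hle⟩ := exists_tsirelsonIter_le hα hξ hθ hθ' s x X hx (ε / 2) (by linarith)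
  exact ⟨L, δ, I, h, by linarith⟩

end IsScheme

/-- The lower estimate for disjointly supported, finitely supported vectors. -/
theorem mul_sum_tsirelsonNorm_le {α : Ordinal.{0} → ℕ+ → Ordinal.{0}} {ξ : Ordinal.{0}} {θ : ℝ}
    (hα : IsApproximatingSystem α) (hξ : ξ < ω₁) (hξ0 : ξ ≠ 0) (hθ : 0 < θ) (hθ' : θ ≤ 1)
    {k : ℕ} (x : Fin k → ℕ+ →₀ ℝ) (hx : ∀ i j, i ≠ j → Disjoint (x i).support (x j).support)
    {m : Fin k → ℕ+} (hm : Function.Injective m) (hmem : Finset.univ.image m ∈ schreier α ξ)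
    (hm2 : ∀ i, 2 ≤ m i) (hle : ∀ i, ∀ n ∈ (x i).support, m i ≤ n) :
    θ * ∑ i, tsirelsonNorm (schreier α ξ) θ (x i) ≤
      3 * tsirelsonNorm (schreier α ξ) θ (∑ i, x i) := by
  refine le_of_forall_pos_le_add fun ε hε => ?_
  have hη : 0 < ε / (k + 1) := by positivity
  choose L δ I h hnorm using fun i => IsScheme.exists_tsirelsonNorm_le hα hξ hθ hθ' (x i)
    (x i).support subset_rfl _ hη
  obtain ⟨L', δ', I', h', hδ', hval⟩ := IsScheme.combine (θ := θ) hα hξ h hx hm hmem hle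
    (Y := Finset.univ.biUnion fun i => (x i).support)
    (fun i => Finset.subset_biUnion_of_mem (fun i => (x i).support) (Finset.mem_univ i))
  have hupper := h'.sum_le hα hξ hξ0 hθ hθ' (fun n hn => by
    obtain ⟨i, -, hi⟩ := Finset.mem_biUnion.1 hn
    exact (hm2 i).trans (hle i n hi)) hδ' (∑ i, x i)
  rw [hval fun n => |(∑ i, x i) n|] at hupper
  have hsum : ∑ i, tsirelsonNorm (schreier α ξ) θ (x i) ≤
      ∑ i, ∑ n ∈ L i, θ ^ δ i n * |(∑ j, x j) n| + ε := by
    calc ∑ i, tsirelsonNorm (schreier α ξ) θ (x i)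
        ≤ ∑ i, (∑ n ∈ L i, θ ^ δ i n * |(∑ j, x j) n| + ε / (k + 1)) := by
          refine Finset.sum_le_sum fun i _ => (hnorm i).trans (le_of_eq ?_)
          congr 1
          refine Finset.sum_congr rfl fun n hn => ?_
          have hn' := (h i).leaf_subset hn
          have : (∑ j, x j) n = x i n := by
            rw [Finsupp.finsetSum_apply]
            refine Finset.sum_eq_single i (fun j _ hji => ?_) fun h => absurd (Finset.mem_univ i) h
            exact Finsupp.notMem_support_iff.1 fun hj =>
              Finset.disjoint_left.1 (hx j i hji) hj hn'
          rw [this]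
      _ = ∑ i, ∑ n ∈ L i, θ ^ δ i n * |(∑ j, x j) n| + k * (ε / (k + 1)) := by
          simp [Finset.sum_add_distrib]
      _ ≤ _ := by
          have : (k : ℝ) * (ε / (k + 1)) ≤ ε := by
            rw [← mul_div_assoc, div_le_iff₀ (by positivity)]
            nlinarith
          linarith
  have := mul_le_mul_of_nonneg_left hsum hθ.le
  nlinarith

/-! ### Truncation and passage to the completion. -/

section Projection

variable {𝓕 : Set (Finset ℕ+)} {θ : ℝ}

theorem tsirelsonIter_proj_le (E : Finset ℕ+) (s : ℕ) (x : ℕ+ →₀ ℝ) :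
    tsirelsonIter 𝓕 θ s (proj E x) ≤ tsirelsonIter 𝓕 θ s x := by
  have h0 : ∀ x : ℕ+ →₀ ℝ, ⨆ n, ‖proj E x n‖ₑ ≤ ⨆ n, ‖x n‖ₑ := fun x =>
    iSup_mono fun n => by
      by_cases h : n ∈ E <;> simp [proj, h]
  induction s generalizing x with
  | zero => exact h0 x
  | succ s ih =>
    refine max_le_max (h0 x) (mul_le_mul_right ?_ _)
    refine iSup_mono fun k => iSup_mono fun F => iSup_mono fun _ =>
      Finset.sum_le_sum fun i _ => ?_
    have : proj (F i) (proj E x) = proj E (proj (F i) x) := by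
      ext n
      by_cases h1 : n ∈ E <;> by_cases h2 : n ∈ F i <;> simp [proj, h1, h2]
    rw [this]
    exact ih _

theorem tsirelsonNorm_proj_le (hθ : θ ≤ 1) (E : Finset ℕ+) (x : ℕ+ →₀ ℝ) :
    tsirelsonNorm 𝓕 θ (proj E x) ≤ tsirelsonNorm 𝓕 θ x :=
  ENNReal.toReal_mono (iSup_tsirelsonIter_ne_top hθ x)
    (iSup_mono fun s => tsirelsonIter_proj_le E s x)

end Projection

namespace TsirelsonSpace

variable {𝓕 : Set (Finset ℕ+)} {θ : Set.Ioo (0 : ℝ) 1}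

/-- The inclusion of `c₀₀` into the Tsirelson space. -/
noncomputable def ofFinsupp : (ℕ+ →₀ ℝ) →ₗ[ℝ] TsirelsonSpace 𝓕 θ :=
  ((UniformSpace.Completion.toComplL : TsirelsonC00 𝓕 θ →L[ℝ] TsirelsonSpace 𝓕 θ) :
    TsirelsonC00 𝓕 θ →ₗ[ℝ] TsirelsonSpace 𝓕 θ)

theorem norm_ofFinsupp (x : ℕ+ →₀ ℝ) :
    ‖(ofFinsupp x : TsirelsonSpace 𝓕 θ)‖ = tsirelsonNorm 𝓕 θ x :=
  UniformSpace.Completion.norm_coe (E := TsirelsonC00 𝓕 θ) x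

theorem coord_ofFinsupp (n : ℕ+) (x : ℕ+ →₀ ℝ) :
    coord n (ofFinsupp x : TsirelsonSpace 𝓕 θ) = x n :=
  ContinuousLinearMap.fromCompletion_apply_coe (TsirelsonC00.coord n) x

/-- The first `N` coordinates of a vector of the Tsirelson space. -/
noncomputable def truncate (N : ℕ+) (y : TsirelsonSpace 𝓕 θ) : ℕ+ →₀ ℝ :=
  ∑ n ∈ Finset.Iic N, Finsupp.single n (coord n y)

theorem truncate_apply (N n : ℕ+) (y : TsirelsonSpace 𝓕 θ) :
    truncate N y n = if n ≤ N then coord n y else 0 := by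
  simp [truncate, Finsupp.finsetSum_apply, Finsupp.single_apply]

theorem truncate_ofFinsupp (N : ℕ+) (x : ℕ+ →₀ ℝ) :
    truncate N (ofFinsupp x : TsirelsonSpace 𝓕 θ) = proj (Finset.Iic N) x := by
  ext n
  rw [truncate_apply, coord_ofFinsupp]
  by_cases h : n ≤ N <;> simp [proj, h]

theorem truncate_support (N : ℕ+) (y : TsirelsonSpace 𝓕 θ) :
    ∀ n ∈ (truncate N y).support, n ∈ supp y := fun n hn h0 => by
  rw [Finsupp.mem_support_iff, truncate_apply] at hn
  simp [h0] at hn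

theorem truncate_sum_smul {k : ℕ} (N : ℕ+) (a : Fin k → ℝ) (y : Fin k → TsirelsonSpace 𝓕 θ) :
    truncate N (∑ j, a j • y j) = ∑ j, a j • truncate N (y j) := by
  ext n
  by_cases h : n ≤ N <;> simp [truncate_apply, Finsupp.finsetSum_apply, h]

theorem truncate_sub (N : ℕ+) (y z : TsirelsonSpace 𝓕 θ) :
    truncate N (y - z) = truncate N y - truncate N z := by
  ext n
  by_cases h : n ≤ N <;> simp [truncate_apply, h]

/-- On finitely supported vectors truncation is a coordinate projection, hence a contraction; both
sides are continuous in `y`. -/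
theorem norm_truncate_le (N : ℕ+) (y : TsirelsonSpace 𝓕 θ) :
    ‖(ofFinsupp (truncate N y) : TsirelsonSpace 𝓕 θ)‖ ≤ ‖y‖ := by
  induction y using UniformSpace.Completion.induction_on with
  | hp =>
    refine isClosed_le (Continuous.norm ?_) continuous_norm
    simp only [truncate, map_sum]
    refine continuous_finsetSum _ fun n _ => ?_
    have (y : TsirelsonSpace 𝓕 θ) : (ofFinsupp (Finsupp.single n (coord n y)) :
        TsirelsonSpace 𝓕 θ) = coord n y • ofFinsupp (Finsupp.single n 1) := by
      rw [← map_smul, Finsupp.smul_single, smul_eq_mul, mul_one]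
    simp only [this]
    exact (coord n).continuous.smul continuous_const
  | ih x =>
    have h := truncate_ofFinsupp (𝓕 := 𝓕) (θ := θ) N x
    have h' := norm_ofFinsupp (𝓕 := 𝓕) (θ := θ) (proj (Finset.Iic N) x)
    rw [← h] at h'
    refine h'.le.trans ?_
    rw [h]
    exact (tsirelsonNorm_proj_le θ.2.2.le _ x).trans (norm_ofFinsupp (𝓕 := 𝓕) (θ := θ) x).ge

/-- The truncations are contractions and eventually fix each finitely supported vector, and these
vectors are dense. -/
theorem tendsto_truncate (y : TsirelsonSpace 𝓕 θ) :
    Filter.Tendsto (fun N => (ofFinsupp (truncate N y) : TsirelsonSpace 𝓕 θ)) Filter.atTop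
      (nhds y) := by
  rw [Metric.tendsto_atTop]
  intro ε hε
  obtain ⟨x, hx⟩ : ∃ x : ℕ+ →₀ ℝ, ‖y - (ofFinsupp x : TsirelsonSpace 𝓕 θ)‖ < ε / 2 := by
    obtain ⟨z, ⟨x, rfl⟩, hz⟩ := Metric.mem_closure_iff.1
      ((UniformSpace.Completion.denseRange_coe (α := TsirelsonC00 𝓕 θ)).closure_range ▸
        Set.mem_univ y) (ε / 2) (by linarith)
    exact ⟨x, by rw [← dist_eq_norm]; exact hz⟩
  refine ⟨x.support.sup id, fun N hN => ?_⟩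
  have hproj : proj (Finset.Iic N) x = x := (Finsupp.filter_eq_self_iff _ _).2 fun n hn =>
    Finset.mem_Iic.2 ((Finset.le_sup (f := id) (Finsupp.mem_support_iff.2 hn)).trans hN)
  have h1 : (ofFinsupp (truncate N (y - ofFinsupp x)) : TsirelsonSpace 𝓕 θ) =
      ofFinsupp (truncate N y) - ofFinsupp x := by
    rw [truncate_sub, map_sub, truncate_ofFinsupp, hproj]
  have h2 := norm_truncate_le N (y - ofFinsupp x)
  rw [h1] at h2
  rw [dist_eq_norm]
  calc ‖(ofFinsupp (truncate N y) : TsirelsonSpace 𝓕 θ) - y‖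
      = ‖(ofFinsupp (truncate N y) - ofFinsupp x) - (y - ofFinsupp x)‖ := by
        congr 1; abel
    _ ≤ _ := norm_sub_le _ _
    _ < ε := by linarith

end TsirelsonSpace

theorem corollary4p10
    (α : Ordinal.{0} → ℕ+ → Ordinal.{0}) (hα : IsApproximatingSystem α)
    (ξ : Ordinal.{0}) (hξ : ξ < ω₁) (θ : Set.Ioo (0 : ℝ) 1)
    (k : ℕ) (y : Fin k → TsirelsonSpace (schreier α ξ) θ)
    (hy : ∀ j, ‖y j‖ = 1)
    (hsupp : IsAllowable (schreier α ξ) fun j => TsirelsonSpace.supp (y j))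
    (a : Fin k → ℝ) :
    (θ : ℝ) / 3 * ∑ j, |a j| ≤ ‖∑ j, a j • y j‖ ∧ ‖∑ j, a j • y j‖ ≤ ∑ j, |a j| := by
  obtain ⟨hθ, hθ'⟩ := θ.2
  constructor
  swap
  · refine (norm_sum_le _ _).trans (Finset.sum_le_sum fun j _ => ?_)
    rw [norm_smul, hy, mul_one, Real.norm_eq_abs]
  -- With two or more vectors, `ξ ≠ 0` and all minima are at least 2, as the lower estimate
  -- requires; fewer vectors are handled directly.
  by_cases hk : Subsingleton (Fin k)
  · rcases isEmpty_or_nonempty (Fin k) with _ | ⟨⟨i⟩⟩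
    · simp
    · have huniv : (Finset.univ : Finset (Fin k)) = {i} :=
        Finset.eq_singleton_iff_unique_mem.2 ⟨Finset.mem_univ _, fun j _ => Subsingleton.elim _ _⟩
      rw [huniv, Finset.sum_singleton, Finset.sum_singleton, norm_smul, hy, mul_one,
        Real.norm_eq_abs]
      exact mul_le_of_le_one_left (abs_nonneg _) (by linarith)
  rw [not_subsingleton_iff_nontrivial] at hk
  obtain ⟨hdisj, m, hm, hmem⟩ := hsupp
  have hminj : Function.Injective m := fun i j hij => by
    by_contra hne
    exact Set.disjoint_left.1 (hdisj i j hne) (hm i).1 (hij ▸ (hm j).1)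
  have hmmem (i) : m i ∈ Finset.univ.image m := Finset.mem_image_of_mem _ (Finset.mem_univ i)
  have hm2 : ∀ i, 2 ≤ m i := fun i => by
    by_contra! hlt
    have h1 : m i = 1 := le_antisymm (Order.lt_succ_iff.1 hlt) one_le
    have hone := eq_one_of_one_mem_schreier hmem (h1 ▸ hmmem i)
    obtain ⟨j, hj⟩ := exists_ne i
    exact hj (hminj ((hone _ (hmmem j)).trans h1.symm))
  have hξ0 : ξ ≠ 0 := by
    rintro rfl
    obtain ⟨i, j, hij⟩ := exists_pair_ne (Fin k)
    exact hij (hminj (Finset.card_le_one.1 (schreier_zero_iff.1 hmem) _ (hmmem i) _ (hmmem j)))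
  have hN : ∀ N, (θ : ℝ) * ∑ j, |a j| *
      ‖(TsirelsonSpace.ofFinsupp (TsirelsonSpace.truncate N (y j)) :
        TsirelsonSpace (schreier α ξ) θ)‖ ≤
      3 * ‖(TsirelsonSpace.ofFinsupp (TsirelsonSpace.truncate N (∑ j, a j • y j)) :
        TsirelsonSpace (schreier α ξ) θ)‖ := fun N => by
    have hsub (j) : ∀ n ∈ (a j • TsirelsonSpace.truncate N (y j)).support,
        n ∈ TsirelsonSpace.supp (y j) := fun n hn =>
      TsirelsonSpace.truncate_support N (y j) n (Finsupp.support_smul hn)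
    have := mul_sum_tsirelsonNorm_le hα hξ hξ0 hθ hθ'.le
      (fun j => a j • TsirelsonSpace.truncate N (y j))
      (fun i j hij => Finset.disjoint_left.2 fun n hi hj =>
        Set.disjoint_left.1 (hdisj i j hij) (hsub i n hi) (hsub j n hj))
      hminj hmem hm2 fun i n hn => (hm i).2 (hsub i n hn)
    simpa only [TsirelsonSpace.norm_ofFinsupp, TsirelsonSpace.truncate_sum_smul,
      tsirelsonNorm_smul] using this
  -- The inequality for truncations, whose supports remain in those of the `y j`, passes to the
  -- limit in `N`.
  have hlim := le_of_tendsto_of_tendsto'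
    ((tendsto_finsetSum Finset.univ fun j _ =>
      (TsirelsonSpace.tendsto_truncate (y j)).norm.const_mul |a j|).const_mul (θ : ℝ))
    ((TsirelsonSpace.tendsto_truncate (∑ j, a j • y j)).norm.const_mul 3) hN
  simp only [hy, mul_one] at hlim
  linarith
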